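/- Let $p,q$ be meromorphic functions on $\mathbb{C}$, and put $$J=\begin{pmatrix} i&0\\0&-i\end{pmatrix},\qquad Q(x)=\begin{pmatrix}0&-iq(x)\\ ip(x)&0\end{pmatrix}.$$ For $E\in\mathbb{C}$ say that the equation $J\Psi'(x)+Q(x)\Psi(x)=E\Psi(x)$ has a meromorphic fundamental system if it has two solutions $\Psi_1,\Psi_2$, with values in $\mathbb{C}^2$ and meromorphic with respect to $x$ on all of $\mathbb{C}$, that are linearly independent over $\mathbb{C}$. Then there is a natural number $N$, depending on $Q$, such that the following holds: if the equation has a meromorphic fundamental system for at least $N$ distinct values of $E\in\mathbb{C}$, then it has a meromorphic fundamental system for every $E\in\mathbb{C}$. -/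

import Mathlib

open Filter
open scoped Matrix

namespace AKNS

/-- The constant matrix `J = diag(i, -i)`. -/
def J : Matrix (Fin 2) (Fin 2) ℂ :=
  !![Complex.I, 0; 0, -Complex.I]

/-- The potential matrix `Q(x)`, with zero diagonal and off-diagonal entries `-i q(x)`, `i p(x)`. -/
def Q (p q : ℂ → ℂ) (x : ℂ) : Matrix (Fin 2) (Fin 2) ℂ :=
  !![0, -Complex.I * q x; Complex.I * p x, 0]

/-- `ψ` is a solution, meromorphic on the whole plane, of `J ψ' + Q ψ = E ψ`.
As usual for meromorphic functions, the values of `p`, `q`, `ψ` on a closed discrete set (which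
contains the poles) are irrelevant, so the equation is required off such a set. -/
structure IsMeromorphicSolution (p q : ℂ → ℂ) (E : ℂ) (ψ : ℂ → Fin 2 → ℂ) : Prop where
  meromorphic : Meromorphic ψ
  equation : ∀ᶠ x in codiscrete ℂ, J *ᵥ deriv ψ x + Q p q x *ᵥ ψ x = E • ψ x

/-- The equation `J ψ' + Q ψ = E ψ` has a fundamental system of solutions meromorphic on `ℂ`:
two meromorphic solutions that are linearly independent over `ℂ` as meromorphic functions, that is,
no nontrivial linear combination vanishes off a closed discrete set. -/
def HasMeromorphicFundamentalSystem (p q : ℂ → ℂ) (E : ℂ) : Prop :=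
  ∃ ψ : Fin 2 → ℂ → Fin 2 → ℂ,
    (∀ k, IsMeromorphicSolution p q E (ψ k)) ∧
    ∀ c : Fin 2 → ℂ, (∀ᶠ x in codiscrete ℂ, ∑ k, c k • ψ k x = 0) → c = 0

end AKNS

/-!
Fix `x₀` and write `z = x - x₀`. The equation is `ψ' = A ψ` with
`A = [[-iE, q], [p, iE]]`, a traceless matrix.

*Local and global solvability.* A meromorphic fundamental system exists on `ℂ` as soon as one exists
near every point (`hasMeromorphicFundamentalSystem_iff`). The Wronskian of two solutions is constant,
so near each point every germ of a solution is a constant combination of the local fundamental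
system and continues to a whole disc; continuation to larger and larger discs about `0` then gives a
solution on the plane (`exists_continuation`). Hence, if some `E₀` is bad, it is bad at a single
point `x₀`, and it suffices that the set of `E` which are good at `x₀` is finite or all of `ℂ`.

*The dichotomy at a point.* If one nonzero meromorphic solution exists for one `E`, comparing orders
in `u' + iE u = q v`, `v' - iE v = p u` shows that the poles of `p` and `q` are so restricted that
a shearing transformation `diag(1, z ^ d)`, independent of `E`, turns the equation into
`z ψ' = (F + E z D) ψ` with `F` analytic (`exists_shear_exponent`). The matrix `F x₀` does not
depend on `E`, so there is `M` independent of `E` such that nonzero solutions have order strictly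
between `-M` and `M`. Therefore `z ^ M ψ` is analytic and determined by its Taylor polynomial of
degree less than `2 M`. Conversely, a polynomial that solves the equation modulo `z ^ (2 M)`
extends to a convergent solution (`exists_analyticAt_singular_solution`). So the solutions
correspond to the kernel of a linear pencil `T + E T'` on a finite-dimensional space, and for a
pencil the condition `2 ≤ dim ker` holds for finitely many `E` or for all
(`finite_setOf_two_le_ker_or_forall`).
-/

namespace AKNS
open scoped Topology

/-! ### Linear pencils -/

/-- For a linear pencil `A + E B` on a finite-dimensional space, the property that the kernel is at
least two-dimensional holds either for finitely many parameters `E` or for all of them. -/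
theorem finite_setOf_two_le_ker_or_forall {V W : Type*} [AddCommGroup V] [Module ℂ V]
    [FiniteDimensional ℂ V] [AddCommGroup W] [Module ℂ W] (A B : V →ₗ[ℂ] W) :
    {E : ℂ | ∃ v : Fin 2 → V, LinearIndependent ℂ v ∧ ∀ k, A (v k) + E • B (v k) = 0}.Finite ∨
      ∀ E : ℂ, ∃ v : Fin 2 → V, LinearIndependent ℂ v ∧ ∀ k, A (v k) + E • B (v k) = 0 := by
  by_contra! h
  obtain ⟨hinf, E₀, hE₀⟩ := h
  apply hinf
  -- The kernel at `E₀` is at most a line, hence is killed by adding one linear form `l`.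
  obtain ⟨l, hl⟩ : ∃ l : V →ₗ[ℂ] ℂ, ∀ w, A w + E₀ • B w = 0 → l w = 0 → w = 0 := by
    by_cases hker : ∃ v, v ≠ 0 ∧ A v + E₀ • B v = 0
    · obtain ⟨v, hv0, hv⟩ := hker
      obtain ⟨l, hlv⟩ := Module.Projective.exists_dual_ne_zero ℂ hv0
      refine ⟨l, fun w hw hlw => by_contra fun hw0 => ?_⟩
      obtain ⟨k, hk⟩ := hE₀ ![v, w] (LinearIndependent.pair_iff.2 fun s t hst => by
        have hs : s = 0 := by simpa [hlw, hlv] using congrArg l hst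
        subst hs
        simpa [hw0] using hst)
      fin_cases k
      · exact hk hv
      · exact hk hw
    · push Not at hker
      exact ⟨0, fun w hw _ => by_contra fun h => hker w h hw⟩
  let T : V →ₗ[ℂ] W × ℂ := (A + E₀ • B).prod l
  obtain ⟨S, hS⟩ := T.exists_leftInverse_of_injective (by
    rw [LinearMap.ker_eq_bot']
    intro w hw
    exact hl w (congrArg Prod.fst hw) (congrArg Prod.snd hw))
  let C : Module.End ℂ V := S ∘ₗ LinearMap.inl ℂ W ℂ ∘ₗ B
  refine ((Module.End.finite_hasEigenvalue C).image (fun μ => E₀ - μ⁻¹) |>.insert E₀).subset ?_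
  rintro E ⟨v, hv, hvE⟩
  rcases eq_or_ne E E₀ with rfl | hne
  · exact Set.mem_insert _ _
  refine Set.mem_insert_of_mem _ ⟨-(E - E₀)⁻¹, ?_, ?_⟩
  · -- a combination `w` of the two kernel vectors on which `l` vanishes
    obtain ⟨w, hw0, hwE, hlw⟩ : ∃ w, w ≠ 0 ∧ A w + E • B w = 0 ∧ l w = 0 := by
      by_cases hl0 : l (v 0) = 0
      · exact ⟨v 0, hv.ne_zero 0, hvE 0, hl0⟩
      · refine ⟨l (v 0) • v 1 - l (v 1) • v 0, fun h => hl0 ?_, ?_, ?_⟩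
        · have := Fintype.linearIndependent_iff.1 hv ![-l (v 1), l (v 0)] (by
            rw [Fin.sum_univ_two, ← h]; simp; abel)
          simpa using this 1
        · have : A (l (v 0) • v 1 - l (v 1) • v 0) + E • B (l (v 0) • v 1 - l (v 1) • v 0)
              = l (v 0) • (A (v 1) + E • B (v 1)) - l (v 1) • (A (v 0) + E • B (v 0)) := by
            simp only [map_sub, map_smul]; module
          rw [this, hvE, hvE]; simp
        · simp [mul_comm]
    have hTw : T w = -(E - E₀) • LinearMap.inl ℂ W ℂ (B w) := by
      refine Prod.ext ?_ ?_
      · change A w + E₀ • B w = -(E - E₀) • B w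
        rw [eq_neg_of_add_eq_zero_left hwE]; module
      · simpa [T] using hlw
    have hw : w = -(E - E₀) • C w := by
      have h1 : S (T w) = w := LinearMap.congr_fun hS w
      rw [hTw, map_smul] at h1
      exact h1.symm
    refine Module.End.hasEigenvalue_of_hasEigenvector (x := w) ⟨?_, hw0⟩
    rw [Module.End.mem_eigenspace_iff]
    conv_rhs => rw [hw]
    rw [smul_smul]
    have : E - E₀ ≠ 0 := sub_ne_zero.2 hne
    field_simp
    simp
  · simp

/-! ### Analytic solutions of singular linear systems of the first kind -/

/-- Taylor coefficients of an analytic germ, with a geometric bound. -/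
theorem exists_coeff_of_analyticAt {f : ℂ → ℂ} {x₀ : ℂ} (hf : AnalyticAt ℂ f x₀) :
    ∃ (c : ℕ → ℂ) (R : ℝ), 0 < R ∧ c 0 = f x₀ ∧ (∀ C ≥ R, ∀ ρ ≥ R, ∀ n, ‖c n‖ ≤ C * ρ ^ n) ∧
      ∀ᶠ x in 𝓝 x₀, HasSum (fun n => c n * (x - x₀) ^ n) (f x) := by
  obtain ⟨p, hp⟩ := hf
  obtain ⟨C, hC, r, hr, hb⟩ : ∃ C > 0, ∃ r > 0, ∀ n, ‖p n‖ ≤ C * r ^ n := by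
    obtain ⟨C, r, hC, hr, hb⟩ := p.le_mul_pow_of_radius_pos hp.radius_pos
    exact ⟨C, hC, r, hr, hb⟩
  refine ⟨p.coeff, max C r, lt_max_of_lt_left hC, ?_, fun C' hC' ρ hρ n => ?_, ?_⟩
  · simpa using hp.coeff_zero (fun _ => 1)
  · rw [← p.norm_apply_eq_norm_coef]
    have h1 : C ≤ C' := (le_max_left _ _).trans hC'
    have h2 : r ≤ ρ := (le_max_right _ _).trans hρ
    have h3 : 0 ≤ C' := hC.le.trans h1
    exact (hb n).trans (by gcongr)
  · filter_upwards [hp.eventually_hasSum_sub] with x hx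
    simpa [FormalMultilinearSeries.apply_eq_pow_smul_coeff, mul_comm] using hx

/-- A sequence defined by a course-of-values recursion. -/
def recSeq {X : Type*} (G : (n : ℕ) → (Fin n → X) → X) : ℕ → X
  | n => G n fun k => recSeq G k

theorem recSeq_eq {X : Type*} (G : (n : ℕ) → (Fin n → X) → X) (n : ℕ) :
    recSeq G n = G n fun k => recSeq G k := by
  rw [recSeq]

theorem sum_range_pow_mul_pow_le {ρ L : ℝ} (hρ : 0 ≤ ρ) (hL : 0 < L) (n : ℕ) :
    ∑ k ∈ Finset.range n, ρ ^ (n - k) * (ρ * (1 + L)) ^ k ≤ (ρ * (1 + L)) ^ n / L := by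
  induction n with
  | zero => simp [hL.le]
  | succ n ih =>
    have : ∑ k ∈ Finset.range (n + 1), ρ ^ (n + 1 - k) * (ρ * (1 + L)) ^ k =
        ρ * (∑ k ∈ Finset.range n, ρ ^ (n - k) * (ρ * (1 + L)) ^ k + (ρ * (1 + L)) ^ n) := by
      rw [Finset.sum_range_succ, mul_add ρ (Finset.sum _ _), Finset.mul_sum]
      congr 1
      · refine Finset.sum_congr rfl fun k hk => ?_
        rw [Nat.succ_sub (Finset.mem_range.1 hk).le, pow_succ]; ring
      · simp
    rw [this]
    calc ρ * (∑ k ∈ Finset.range n, ρ ^ (n - k) * (ρ * (1 + L)) ^ k + (ρ * (1 + L)) ^ n)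
        ≤ ρ * ((ρ * (1 + L)) ^ n / L + (ρ * (1 + L)) ^ n) := by gcongr
      _ = (ρ * (1 + L)) ^ (n + 1) / L := by field_simp; ring

theorem norm_mulVec_le_of_row_sum_le {ι : Type*} [Fintype ι] (A : Matrix ι ι ℂ) {κ : ℝ}
    (hκ : 0 ≤ κ) (hA : ∀ i, ∑ j, ‖A i j‖ ≤ κ) (v : ι → ℂ) : ‖A *ᵥ v‖ ≤ κ * ‖v‖ := by
  refine (pi_norm_le_iff_of_nonneg (by positivity)).2 fun i => ?_
  calc ‖(A *ᵥ v) i‖ ≤ ∑ j, ‖A i j * v j‖ := norm_sum_le _ _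
    _ ≤ ∑ j, ‖A i j‖ * ‖v‖ := by
        refine Finset.sum_le_sum fun j _ => ?_
        rw [norm_mul]; gcongr; exact norm_le_pi_norm v j
    _ ≤ κ * ‖v‖ := by rw [← Finset.sum_mul]; gcongr; exact hA i

theorem exists_smul_sub_mulVec_eq {ι : Type*} [Fintype ι] (A : Matrix ι ι ℂ) {K : ℝ}
    (hA : ∀ i, ∑ j, ‖A i j‖ ≤ K) (hK : 0 ≤ K) {a : ℝ} (ha : K + 1 ≤ a) (w : ι → ℂ) :
    ∃ v : ι → ℂ, (a : ℂ) • v - A *ᵥ v = w ∧ ‖v‖ ≤ ‖w‖ := by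
  have hbound : ∀ v : ι → ℂ, ‖v‖ ≤ ‖(a : ℂ) • v - A *ᵥ v‖ := fun v => by
    have h1 := norm_mulVec_le_of_row_sum_le A hK hA v
    have h2 : ‖(a : ℂ) • v‖ = a * ‖v‖ := by
      rw [norm_smul, Complex.norm_real, Real.norm_of_nonneg (by linarith)]
    have h3 := norm_sub_norm_le ((a : ℂ) • v) (A *ᵥ v)
    nlinarith [norm_nonneg v]
  let T : (ι → ℂ) →ₗ[ℂ] (ι → ℂ) := (a : ℂ) • LinearMap.id - A.mulVecLin
  have hT : ∀ v, T v = (a : ℂ) • v - A *ᵥ v := fun v => by simp [T]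
  have hinj : Function.Injective T := by
    rw [← LinearMap.ker_eq_bot, LinearMap.ker_eq_bot']
    intro v hv
    have := hbound v
    rw [← hT, hv, norm_zero] at this
    exact norm_le_zero_iff.1 this
  obtain ⟨v, hv⟩ := LinearMap.injective_iff_surjective.1 hinj w
  exact ⟨v, by rw [← hT, hv], by rw [← hv, hT]; exact hbound v⟩

/-- The formal solution of `z y' + K y = F y + h`, with a geometric bound on its coefficients. -/
theorem exists_coeff_solution {ι : Type*} [Fintype ι] (c : ℕ → Matrix ι ι ℂ) (H : ℕ → ι → ℂ)
    {C ρ K : ℝ} (hC : 0 < C) (hρ : 0 < ρ) (hc : ∀ n i j, ‖c n i j‖ ≤ C * ρ ^ n)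
    (hH : ∀ n i, ‖H n i‖ ≤ C * ρ ^ n) (hK : ∀ i, ∑ j, ‖c 0 i j‖ + 1 ≤ K) (hK1 : 1 ≤ K) :
    ∃ (y : ℕ → ι → ℂ) (B S : ℝ), 0 < B ∧ 0 < S ∧ (∀ n, ‖y n‖ ≤ B * S ^ n) ∧
      ∀ (n : ℕ) i, ((n : ℂ) + K) * y n i =
        H n i + ∑ j, ∑ k ∈ Finset.range (n + 1), y k j * c (n - k) i j := by
  have hsolve : ∀ (n : ℕ) (w : ι → ℂ), ∃ v : ι → ℂ,
      ((n + K : ℝ) : ℂ) • v - c 0 *ᵥ v = w ∧ ‖v‖ ≤ ‖w‖ := fun n w =>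
    exists_smul_sub_mulVec_eq (c 0) (K := K - 1) (fun i => by linarith [hK i]) (by linarith)
      (by linarith [(Nat.cast_nonneg n : (0 : ℝ) ≤ n)]) w
  choose s hs hsn using hsolve
  let y : ℕ → ι → ℂ := recSeq fun n y => s n (H n + ∑ k : Fin n, c (n - k) *ᵥ y k)
  have hy : ∀ n, y n = s n (H n + ∑ k ∈ Finset.range n, c (n - k) *ᵥ y k) := fun n => by
    rw [Finset.sum_range fun k => c (n - k) *ᵥ y k]
    exact recSeq_eq _ n
  set d : ℝ := (Fintype.card ι : ℝ)
  set L : ℝ := 2 * d * C + 1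
  have hL : 0 < L := by positivity
  refine ⟨y, 2 * C, ρ * (1 + L), by positivity, by positivity, fun n => ?_, fun n i => ?_⟩
  · induction n using Nat.strong_induction_on with
    | _ n ih =>
      rw [hy]
      refine (hsn _ _).trans ((norm_add_le _ _).trans ?_)
      have h1 : ‖H n‖ ≤ C * (ρ * (1 + L)) ^ n := by
        refine (pi_norm_le_iff_of_nonneg (by positivity)).2 fun i => (hH n i).trans ?_
        gcongr
        nlinarith
      have h2 : ‖∑ k ∈ Finset.range n, c (n - k) *ᵥ y k‖ ≤ C * (ρ * (1 + L)) ^ n := by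
        calc ‖∑ k ∈ Finset.range n, c (n - k) *ᵥ y k‖
            ≤ ∑ k ∈ Finset.range n, ‖c (n - k) *ᵥ y k‖ := norm_sum_le _ _
          _ ≤ ∑ k ∈ Finset.range n, d * (C * ρ ^ (n - k)) * (2 * C * (ρ * (1 + L)) ^ k) := by
              refine Finset.sum_le_sum fun k hk => ?_
              refine (norm_mulVec_le_of_row_sum_le _ (κ := d * (C * ρ ^ (n - k)))
                (by positivity) (fun i => ?_) _).trans ?_
              · calc ∑ j, ‖c (n - k) i j‖ ≤ ∑ _j : ι, C * ρ ^ (n - k) :=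
                      Finset.sum_le_sum fun j _ => hc _ _ _
                  _ = d * (C * ρ ^ (n - k)) := by simp [d]
              · gcongr
                exact ih k (Finset.mem_range.1 hk)
          _ = (2 * d * C) * C * ∑ k ∈ Finset.range n, ρ ^ (n - k) * (ρ * (1 + L)) ^ k := by
              rw [Finset.mul_sum]
              exact Finset.sum_congr rfl fun k _ => by ring
          _ ≤ L * C * ((ρ * (1 + L)) ^ n / L) := by
              have h3 : 2 * d * C ≤ L := le_add_of_nonneg_right zero_le_one
              have h4 := sum_range_pow_mul_pow_le hρ.le hL n
              exact mul_le_mul (mul_le_mul_of_nonneg_right h3 hC.le) h4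
                (Finset.sum_nonneg fun k _ => by positivity) (by positivity)
          _ = C * (ρ * (1 + L)) ^ n := by field_simp
      linarith
  · have h := congrFun (hs n (H n + ∑ k ∈ Finset.range n, c (n - k) *ᵥ y k)) i
    rw [← hy n] at h
    simp only [Pi.sub_apply, Pi.smul_apply, Pi.add_apply, Finset.sum_apply, smul_eq_mul,
      Matrix.mulVec, dotProduct] at h
    rw [Finset.sum_comm] at h
    simp only [Finset.sum_range_succ, Nat.sub_self, Finset.sum_add_distrib]
    push_cast at h
    rw [sub_eq_iff_eq_add] at h
    rw [h, add_assoc]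
    simp only [mul_comm]

/-- A singular system `z y' + K y = F y + h`, `z = x - x₀`, with analytic data has an analytic
solution when `K` exceeds the norm of `F x₀` by at least one, so that no `n + K` is an eigenvalue
of `F x₀` and the recursion for the Taylor coefficients of `y` can be solved with bounded
inverses. -/
theorem exists_analyticAt_singular_solution {ι : Type*} [Fintype ι] {x₀ : ℂ}
    {F : ℂ → Matrix ι ι ℂ} {h : ℂ → ι → ℂ} (hF : ∀ i j, AnalyticAt ℂ (fun x => F x i j) x₀)
    (hh : ∀ i, AnalyticAt ℂ (fun x => h x i) x₀) {K : ℝ}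
    (hK : ∀ i, ∑ j, ‖F x₀ i j‖ + 1 ≤ K) (hK1 : 1 ≤ K) :
    ∃ y : ℂ → ι → ℂ, AnalyticAt ℂ y x₀ ∧
      ∀ᶠ x in 𝓝 x₀, (x - x₀) • deriv y x + (K : ℂ) • y x = F x *ᵥ y x + h x := by
  choose c R hR hc0 hcR hcF using fun i j => exists_coeff_of_analyticAt (hF i j)
  choose H R' hR' _ hHR hHh using fun i => exists_coeff_of_analyticAt (hh i)
  set C : ℝ := 1 + (∑ i, ∑ j, R i j + ∑ i, R' i) with hCdef
  have hC : 0 < C := by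
    have h1 : 0 ≤ ∑ i, ∑ j, R i j :=
      Finset.sum_nonneg fun i _ => Finset.sum_nonneg fun j _ => (hR i j).le
    have h2 : 0 ≤ ∑ i, R' i := Finset.sum_nonneg fun i _ => (hR' i).le
    linarith
  have hRC : ∀ i j, R i j ≤ C := fun i j => by
    have h1 : R i j ≤ ∑ j, R i j :=
      Finset.single_le_sum (f := fun j => R i j) (fun j _ => (hR i j).le) (Finset.mem_univ j)
    have h2 : ∑ j, R i j ≤ ∑ i, ∑ j, R i j :=
      Finset.single_le_sum (f := fun i => ∑ j, R i j)
        (fun i _ => Finset.sum_nonneg fun j _ => (hR i j).le) (Finset.mem_univ i)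
    have h3 : 0 ≤ ∑ i, R' i := Finset.sum_nonneg fun i _ => (hR' i).le
    linarith
  have hRC' : ∀ i, R' i ≤ C := fun i => by
    have h1 : 0 ≤ ∑ i, ∑ j, R i j :=
      Finset.sum_nonneg fun i _ => Finset.sum_nonneg fun j _ => (hR i j).le
    have h2 : R' i ≤ ∑ i, R' i :=
      Finset.single_le_sum (f := R') (fun i _ => (hR' i).le) (Finset.mem_univ i)
    linarith
  obtain ⟨y, B, S, hB, hS, hyB, hy⟩ := exists_coeff_solution
    (fun n => Matrix.of fun i j => c i j n) (fun n i => H i n) hC hC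
    (fun n i j => hcR i j C (hRC i j) C (hRC i j) n)
    (fun n i => hHR i C (hRC' i) C (hRC' i) n)
    (K := K) (fun i => by simpa [hc0] using hK i) hK1
  set r : ℝ := (2 * S)⁻¹ with hr
  have hr0 : 0 < r := by positivity
  set U := Metric.ball x₀ r with hU
  have hterm : ∀ i n, ∀ x ∈ U, ‖y n i * (x - x₀) ^ n‖ ≤ B * (1 / 2) ^ n := fun i n x hx => by
    rw [norm_mul, norm_pow]
    have h1 : ‖y n i‖ ≤ B * S ^ n := (norm_le_pi_norm (y n) i).trans (hyB n)
    have h2 : ‖x - x₀‖ ≤ r := (mem_ball_iff_norm.1 hx).le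
    calc ‖y n i‖ * ‖x - x₀‖ ^ n ≤ B * S ^ n * r ^ n := by gcongr
      _ = B * (S * r) ^ n := by rw [mul_pow]; ring
      _ = B * (1 / 2) ^ n := by rw [hr]; congr 2; field_simp
  have hsum : Summable fun n : ℕ => B * (1 / 2 : ℝ) ^ n := summable_geometric_two.mul_left B
  have hdiff : ∀ i n, DifferentiableOn ℂ (fun x => y n i * (x - x₀) ^ n) U := fun i n => by
    fun_prop
  have hUo : IsOpen U := Metric.isOpen_ball
  have hUx : U ∈ 𝓝 x₀ := Metric.ball_mem_nhds _ hr0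
  set Y : ℂ → ι → ℂ := fun x i => ∑' n, y n i * (x - x₀) ^ n with hY
  have hYd : ∀ i, DifferentiableOn ℂ (fun x => Y x i) U := fun i =>
    Complex.differentiableOn_tsum_of_summable_norm hsum (hdiff i) hUo (hterm i)
  refine ⟨Y, (differentiableOn_pi.2 hYd).analyticAt hUx, ?_⟩
  filter_upwards [hUx, eventually_all.2 fun i => eventually_all.2 fun j => hcF i j,
    eventually_all.2 hHh] with x hxU hxF hxh
  have hYx : ∀ i, HasSum (fun n => y n i * (x - x₀) ^ n) (Y x i) := fun i =>
    (Summable.of_norm_bounded hsum fun n => hterm i n x hxU).hasSum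
  have hderiv : ∀ i, deriv Y x i = deriv (fun x => Y x i) x := fun i =>
    congrFun (deriv_pi fun i => (hYd i).differentiableAt (hUo.mem_nhds hxU)) i
  ext i
  simp only [Pi.add_apply, Pi.smul_apply, smul_eq_mul, hderiv, Matrix.mulVec, dotProduct]
  have hdsum := Complex.hasSum_deriv_of_summable_norm hsum (hdiff i) hUo (hterm i) hxU
  have hl := (hdsum.mul_left (x - x₀)).add ((hYx i).mul_left (K : ℂ))
  have hr' := (hasSum_sum fun j (_ : j ∈ Finset.univ) =>
    hasSum_sum_range_mul_of_summable_norm (hYx j).summable.norm (hxF i j).summable.norm).add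
      (hxh i)
  simp only [(hYx _).tsum_eq, (hxF i _).tsum_eq] at hr'
  have hrhs : ∑ j, F x i j * Y x j + h x i = ∑ j, Y x j * F x i j + h x i := by
    simp only [mul_comm]
  rw [hrhs]
  refine HasSum.unique hl ?_
  convert! hr' using 1
  ext n
  have hd : (x - x₀) * deriv (fun x => y n i * (x - x₀) ^ n) x = n * y n i * (x - x₀) ^ n := by
    have : HasDerivAt (fun x => y n i * (x - x₀) ^ n) (y n i * (n * (x - x₀) ^ (n - 1) * 1)) x :=
      (((hasDerivAt_id x).sub_const x₀).pow n).const_mul _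
    rw [this.deriv]
    rcases n with _ | n
    · simp
    · simp [pow_succ]; ring
  rw [hd]
  have hsumn : ∀ j, ∑ k ∈ Finset.range (n + 1), y k j * (x - x₀) ^ k *
      (c i j (n - k) * (x - x₀) ^ (n - k)) =
      (∑ k ∈ Finset.range (n + 1), y k j * c i j (n - k)) * (x - x₀) ^ n := fun j => by
    rw [Finset.sum_mul]
    refine Finset.sum_congr rfl fun k hk => ?_
    rw [← Nat.add_sub_of_le (Nat.lt_succ_iff.1 (Finset.mem_range.1 hk)), pow_add,
      Nat.add_sub_cancel_left]
    ring
  simp only [hsumn, ← Finset.sum_mul]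
  have := hy n i
  simp only [Matrix.of_apply] at this
  linear_combination (x - x₀) ^ n * this

/-! ### Germs of meromorphic solutions at a singularity of the first kind -/

section Germs

variable {ι : Type*} [Fintype ι] {x₀ : ℂ}

/-- `ψ` is meromorphic at `x₀` and solves `ψ' = A ψ` in a punctured neighbourhood of `x₀`. -/
structure IsGermSolution (A : ℂ → Matrix ι ι ℂ) (x₀ : ℂ) (ψ : ℂ → ι → ℂ) : Prop where
  meromorphicAt : MeromorphicAt ψ x₀
  equation : ∀ᶠ x in 𝓝[≠] x₀, deriv ψ x = A x *ᵥ ψ x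

/-- The system `ψ' = A ψ` has two solutions meromorphic at `x₀` whose germs at `x₀` are linearly
independent. -/
def HasTwoGermSolutions (A : ℂ → Matrix ι ι ℂ) (x₀ : ℂ) : Prop :=
  ∃ ψ : Fin 2 → ℂ → ι → ℂ, (∀ k, IsGermSolution A x₀ (ψ k)) ∧
    ∀ c : Fin 2 → ℂ, (∀ᶠ x in 𝓝[≠] x₀, ∑ k, c k • ψ k x = 0) → c = 0

theorem eventually_eventuallyEq_nhds {X : Type*} {f g : ℂ → X} (h : f =ᶠ[𝓝[≠] x₀] g) :
    ∀ᶠ x in 𝓝[≠] x₀, f =ᶠ[𝓝 x] g := by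
  filter_upwards [eventually_eventually_nhdsWithin.2 h, self_mem_nhdsWithin] with x hx hx0
  rwa [IsOpen.nhdsWithin_eq isOpen_compl_singleton hx0] at hx

theorem IsGermSolution.congr {A B : ℂ → Matrix ι ι ℂ} {φ ψ : ℂ → ι → ℂ}
    (h : IsGermSolution A x₀ φ) (hA : A =ᶠ[𝓝[≠] x₀] B) (hψ : φ =ᶠ[𝓝[≠] x₀] ψ) :
    IsGermSolution B x₀ ψ := by
  refine ⟨h.meromorphicAt.congr hψ, ?_⟩
  filter_upwards [h.equation, hA, hψ, eventually_eventuallyEq_nhds hψ] with x h1 h2 h3 h4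
  rw [← h4.deriv_eq, ← h3, ← h2, h1]

theorem HasTwoGermSolutions.congr {A B : ℂ → Matrix ι ι ℂ} (h : HasTwoGermSolutions A x₀)
    (hA : A =ᶠ[𝓝[≠] x₀] B) : HasTwoGermSolutions B x₀ := by
  obtain ⟨ψ, hψ, hc⟩ := h
  exact ⟨ψ, fun k => (hψ k).congr hA EventuallyEq.rfl, hc⟩

theorem IsGermSolution.sum_smul {κ : Type*} [Fintype κ] {A : ℂ → Matrix ι ι ℂ}
    {ψ : κ → ℂ → ι → ℂ} (h : ∀ k, IsGermSolution A x₀ (ψ k)) (c : κ → ℂ) :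
    IsGermSolution A x₀ (fun x => ∑ k, c k • ψ k x) := by
  refine ⟨MeromorphicAt.fun_sum fun k _ => (h k).meromorphicAt.const_smul (c k), ?_⟩
  filter_upwards [eventually_all.2 fun k => (h k).equation,
    eventually_all.2 fun k => (h k).meromorphicAt.eventually_analyticAt] with x h1 h2
  have : HasDerivAt (fun x => ∑ k, c k • ψ k x) (∑ k, c k • deriv (ψ k) x) x :=
    HasDerivAt.fun_sum fun k _ => (h2 k).differentiableAt.hasDerivAt.const_smul (c k)
  rw [this.deriv, Matrix.mulVec_sum]
  exact Finset.sum_congr rfl fun k _ => by rw [h1, Matrix.mulVec_smul]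

/-- Splitting off a power of `z = x - x₀` from a solution of `z ψ' = F ψ`. -/
theorem eventually_deriv_zpow_smul_iff {F : ℂ → Matrix ι ι ℂ} {ψ Y : ℂ → ι → ℂ} {n : ℤ}
    (hY : AnalyticAt ℂ Y x₀) (hψ : ψ =ᶠ[𝓝[≠] x₀] fun x => (x - x₀) ^ n • Y x) :
    ∀ᶠ x in 𝓝[≠] x₀, (deriv ψ x = ((x - x₀)⁻¹ • F x) *ᵥ ψ x ↔
      (x - x₀) • deriv Y x + (n : ℂ) • Y x = F x *ᵥ Y x) := by
  filter_upwards [hψ, eventually_eventuallyEq_nhds hψ, self_mem_nhdsWithin,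
    hY.eventually_analyticAt.filter_mono nhdsWithin_le_nhds] with x h1 h2 h3 h4
  have h0 : x - x₀ ≠ 0 := sub_ne_zero.2 h3
  have hz : HasDerivAt (fun x => (x - x₀) ^ n) (n * (x - x₀) ^ (n - 1)) x :=
    (hasDerivAt_zpow n (x - x₀) (Or.inl h0)).comp_sub_const x x₀
  have hd := (hz.smul h4.differentiableAt.hasDerivAt).deriv
  rw [h2.deriv_eq]
  have hne : (x - x₀) ^ (n - 1) ≠ 0 := zpow_ne_zero _ h0
  have e1 : deriv (fun x => (x - x₀) ^ n • Y x) x =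
      (x - x₀) ^ (n - 1) • ((x - x₀) • deriv Y x + (n : ℂ) • Y x) := by
    refine hd.trans ?_
    rw [zpow_sub_one₀ h0]
    ext i
    simp only [Pi.add_apply, Pi.smul_apply, smul_eq_mul]
    field_simp
  have e2 : ((x - x₀)⁻¹ • F x) *ᵥ ψ x = (x - x₀) ^ (n - 1) • (F x *ᵥ Y x) := by
    rw [h1, Matrix.mulVec_smul, Matrix.smul_mulVec, smul_smul, zpow_sub_one₀ h0]
  rw [e1, e2]
  exact (smul_right_injective _ hne).eq_iff

theorem analyticAt_mulVec {F : ℂ → Matrix ι ι ℂ} {y : ℂ → ι → ℂ}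
    (hF : ∀ i j, AnalyticAt ℂ (fun x => F x i j) x₀) (hy : AnalyticAt ℂ y x₀) :
    AnalyticAt ℂ (fun x => F x *ᵥ y x) x₀ := by
  rw [analyticAt_pi_iff] at hy ⊢
  intro i
  simp only [Matrix.mulVec, dotProduct]
  exact Finset.analyticAt_fun_sum _ fun j _ => (hF i j).mul (hy j)

theorem eventuallyEq_nhds_of_analyticAt {X : Type*} [NormedAddCommGroup X] [NormedSpace ℂ X]
    {f g : ℂ → X} (hf : AnalyticAt ℂ f x₀)
    (hg : AnalyticAt ℂ g x₀) (h : f =ᶠ[𝓝[≠] x₀] g) : f =ᶠ[𝓝 x₀] g :=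
  (hf.frequently_eq_iff_eventually_eq hg).1 h.frequently

/-- The order at `x₀` of a nonzero solution of `z ψ' = F ψ` is an eigenvalue of `F x₀`, hence
bounded by any row-sum bound of that matrix. -/
theorem abs_order_le {F : ℂ → Matrix ι ι ℂ} {ψ : ℂ → ι → ℂ} {κ : ℝ} (hκ : 0 ≤ κ)
    (hF : ∀ i j, AnalyticAt ℂ (fun x => F x i j) x₀) (hFκ : ∀ i, ∑ j, ‖F x₀ i j‖ ≤ κ)
    (hψ : IsGermSolution (fun x => (x - x₀)⁻¹ • F x) x₀ ψ) {n : ℤ}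
    (hn : meromorphicOrderAt ψ x₀ = n) : |(n : ℝ)| ≤ κ := by
  obtain ⟨Y, hY, hY0, hψY⟩ := (meromorphicOrderAt_eq_int_iff hψ.meromorphicAt).1 hn
  have heq : (fun x => (x - x₀) • deriv Y x + (n : ℂ) • Y x) =ᶠ[𝓝 x₀] fun x => F x *ᵥ Y x := by
    have hYd := hY.deriv
    refine eventuallyEq_nhds_of_analyticAt (by fun_prop) (analyticAt_mulVec hF hY) ?_
    filter_upwards [hψ.equation, eventually_deriv_zpow_smul_iff (F := F) hY hψY] with x h1 h2
    exact h2.1 h1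
  have h0 := heq.eq_of_nhds
  simp only [sub_self, zero_smul, zero_add] at h0
  have h1 := norm_mulVec_le_of_row_sum_le (F x₀) hκ hFκ (Y x₀)
  rw [← h0, norm_smul, Complex.norm_intCast] at h1
  exact le_of_mul_le_mul_right h1 (norm_pos_iff.2 hY0)

/-! ### Polynomial jets of solutions -/

/-- The vector of polynomials in `x - x₀` of degree less than `m` with coefficients `v`. -/
def jet (x₀ : ℂ) (m : ℕ) : (ι → Fin m → ℂ) →ₗ[ℂ] (ℂ → ι → ℂ) where
  toFun v x i := ∑ k, v i k * (x - x₀) ^ (k : ℕ)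
  map_add' v w := by ext; simp [add_mul, Finset.sum_add_distrib]
  map_smul' c v := by ext; simp [Finset.mul_sum, mul_assoc]

theorem jet_apply {ι : Type*} (m : ℕ) (v : ι → Fin m → ℂ) (x : ℂ) (i : ι) :
    jet x₀ m v x i = ∑ k, v i k * (x - x₀) ^ (k : ℕ) := rfl

/-- The Euler operator `z d/dz` on coefficient vectors. -/
def eulerOp (m : ℕ) : (ι → Fin m → ℂ) →ₗ[ℂ] (ι → Fin m → ℂ) where
  toFun v i k := (k : ℕ) * v i k
  map_add' v w := by ext; simp [mul_add]
  map_smul' c v := by ext; simp [mul_left_comm]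

theorem analyticAt_jet (m : ℕ) (v : ι → Fin m → ℂ) (x : ℂ) : AnalyticAt ℂ (jet x₀ m v) x := by
  rw [analyticAt_pi_iff]
  intro i
  simp only [jet_apply]
  exact Finset.analyticAt_fun_sum _ fun k _ => by fun_prop

theorem smul_deriv_jet (m : ℕ) (v : ι → Fin m → ℂ) (x : ℂ) :
    (x - x₀) • deriv (jet x₀ m v) x = jet x₀ m (eulerOp m v) x := by
  have h : HasDerivAt (jet x₀ m v)
      (fun i => ∑ k : Fin m, v i k * ((k : ℕ) * (x - x₀) ^ ((k : ℕ) - 1) * 1)) x := by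
    rw [hasDerivAt_pi]
    intro i
    exact HasDerivAt.fun_sum (u := Finset.univ)
      (A := fun (k : Fin m) x => v i k * (x - x₀) ^ (k : ℕ)) fun k _ =>
        (((hasDerivAt_id x).sub_const x₀).pow (k : ℕ)).const_mul _
  rw [h.deriv]
  ext i
  simp only [Pi.smul_apply, smul_eq_mul, jet_apply, eulerOp, LinearMap.coe_mk, AddHom.coe_mk,
    Finset.mul_sum]
  refine Finset.sum_congr rfl fun k _ => ?_
  rcases (k : ℕ) with _ | n
  · simp
  · simp [pow_succ]; ring

/-- The functions that agree near `x₀` with `(x - x₀) ^ m` times an analytic function. -/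
def vanishingGerms (ι : Type*) [Fintype ι] (x₀ : ℂ) (m : ℕ) : Submodule ℂ (ℂ → ι → ℂ) where
  carrier := {f | ∃ g, AnalyticAt ℂ g x₀ ∧ f =ᶠ[𝓝 x₀] fun x => (x - x₀) ^ m • g x}
  add_mem' := by
    rintro _ _ ⟨g, hg, h⟩ ⟨g', hg', h'⟩
    refine ⟨g + g', hg.add hg', ?_⟩
    filter_upwards [h, h'] with x hx hx'
    simp [hx, hx']
  zero_mem' := ⟨0, analyticAt_const, Eventually.of_forall fun x => by simp⟩
  smul_mem' := by
    rintro c _ ⟨g, hg, h⟩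
    refine ⟨c • g, hg.const_smul, ?_⟩
    filter_upwards [h] with x hx
    simp [hx, smul_comm c]

theorem exists_eq_sum_add_pow_mul {f : ℂ → ℂ} (hf : AnalyticAt ℂ f x₀) (m : ℕ) :
    ∃ (v : Fin m → ℂ) (g : ℂ → ℂ), AnalyticAt ℂ g x₀ ∧
      ∀ x, f x = ∑ k, v k * (x - x₀) ^ (k : ℕ) + (x - x₀) ^ m * g x := by
  induction m generalizing f with
  | zero => exact ⟨Fin.elim0, f, hf, by simp⟩
  | succ m ih =>
    have hd : AnalyticAt ℂ (dslope f x₀) x₀ := by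
      obtain ⟨p, hp⟩ := hf
      exact ⟨_, hp.has_fpower_series_dslope_fslope⟩
    obtain ⟨v, g, hg, h⟩ := ih hd
    refine ⟨Fin.cons (f x₀) v, g, hg, fun x => ?_⟩
    have h1 : f x = f x₀ + (x - x₀) * dslope f x₀ x := by
      have := sub_smul_dslope f x₀ x
      rw [smul_eq_mul] at this
      rw [this]; ring
    rw [h1, h x, Fin.sum_univ_succ]
    simp only [Fin.cons_zero, Fin.cons_succ, Fin.val_zero, Fin.val_succ, pow_succ]
    rw [mul_add, Finset.mul_sum]
    simp only [pow_zero, mul_one]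
    rw [add_assoc]
    congr 2
    · exact Finset.sum_congr rfl fun k _ => by ring
    · ring

theorem eq_zero_of_sum_eq_pow_mul {m : ℕ} {v : Fin m → ℂ} {g : ℂ → ℂ} (hg : AnalyticAt ℂ g x₀)
    (h : ∀ᶠ x in 𝓝[≠] x₀, ∑ k, v k * (x - x₀) ^ (k : ℕ) = (x - x₀) ^ m * g x) : v = 0 := by
  induction m with
  | zero => exact Subsingleton.elim _ _
  | succ m ih =>
    have h' := eventuallyEq_nhds_of_analyticAt
      (Finset.analyticAt_fun_sum _ fun k _ => by fun_prop) (by fun_prop) h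
    have h0 : v 0 = 0 := by
      have := h'.eq_of_nhds
      simpa [Fin.sum_univ_succ] using this
    have ht : (fun k : Fin m => v k.succ) = 0 := by
      refine ih ?_
      filter_upwards [h, self_mem_nhdsWithin] with x hx hx0
      have hx0 : x - x₀ ≠ 0 := sub_ne_zero.2 hx0
      rw [Fin.sum_univ_succ, h0, zero_mul, zero_add] at hx
      refine mul_left_cancel₀ hx0 ?_
      rw [Finset.mul_sum, ← mul_assoc, ← pow_succ', ← hx]
      exact Finset.sum_congr rfl fun k _ => by rw [Fin.val_succ, pow_succ]; ring
    ext k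
    refine Fin.cases h0 (fun k => ?_) k
    exact congrFun ht k

/-- The defect of the polynomial vector with coefficients `v` in the equation `z Y' = M Y + F Y`,
where `z = x - x₀`. -/
def jetDefect (F : ℂ → Matrix ι ι ℂ) (x₀ : ℂ) (M m : ℕ) :
    (ι → Fin m → ℂ) →ₗ[ℂ] (ℂ → ι → ℂ) where
  toFun v x := jet x₀ m (eulerOp m v) x - (M : ℂ) • jet x₀ m v x - F x *ᵥ jet x₀ m v x
  map_add' v w := by
    ext x : 1
    simp only [map_add, Pi.add_apply, Matrix.mulVec_add]
    module
  map_smul' c v := by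
    ext x : 1
    simp only [map_smul, Pi.smul_apply, Matrix.mulVec_smul, RingHom.id_apply]
    module

theorem smul_deriv_pow_smul {h : ℂ → ι → ℂ} {x : ℂ} (hh : AnalyticAt ℂ h x) (m : ℕ) :
    (x - x₀) • deriv (fun x => (x - x₀) ^ m • h x) x =
      (x - x₀) ^ m • ((m : ℂ) • h x + (x - x₀) • deriv h x) := by
  have hz : HasDerivAt (fun x => (x - x₀) ^ m) ((m : ℂ) * (x - x₀) ^ (m - 1)) x := by
    simpa using (hasDerivAt_pow m (x - x₀)).comp_sub_const x x₀
  have hd : HasDerivAt (fun x => (x - x₀) ^ m • h x) _ x :=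
    hz.smul hh.differentiableAt.hasDerivAt
  rw [hd.deriv]
  rcases m with _ | m
  · simp
  · simp only [Nat.add_sub_cancel, pow_succ]
    module

variable {F : ℂ → Matrix ι ι ℂ} {M : ℕ}

/-- Up to the factor `z ^ (-M)`, a meromorphic solution of `z ψ' = F ψ` is a polynomial of degree
less than `2 M` up to an error of order `2 M`, because its order is at least `-M`. -/
theorem IsGermSolution.exists_jet (hF : ∀ i j, AnalyticAt ℂ (fun x => F x i j) x₀)
    (hM : ∀ i, ∑ j, ‖F x₀ i j‖ + 1 ≤ M) (hM1 : 1 ≤ M) {ψ : ℂ → ι → ℂ}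
    (hψ : IsGermSolution (fun x => (x - x₀)⁻¹ • F x) x₀ ψ) :
    ∃ (v : ι → Fin (2 * M) → ℂ) (h : ℂ → ι → ℂ), AnalyticAt ℂ h x₀ ∧
      (ψ =ᶠ[𝓝[≠] x₀] fun x =>
        (x - x₀) ^ (-M : ℤ) • (jet x₀ (2 * M) v x + (x - x₀) ^ (2 * M) • h x)) ∧
      jetDefect F x₀ M (2 * M) v ∈ vanishingGerms ι x₀ (2 * M) := by
  have hM1' : (1 : ℝ) ≤ M := by exact_mod_cast hM1
  have hord : (-(M : ℤ) : ℤ) ≤ meromorphicOrderAt ψ x₀ := by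
    cases hn : meromorphicOrderAt ψ x₀ with
    | top => exact le_top
    | coe n =>
      have h1 := abs_order_le (κ := M - 1) (by linarith) hF
        (fun i => by linarith [hM i]) hψ hn
      have h2 : (-(M : ℤ) : ℝ) ≤ n := by
        have := neg_abs_le (n : ℝ)
        push_cast
        linarith
      exact_mod_cast h2
  obtain ⟨Y, hY, hψY⟩ : ∃ Y : ℂ → ι → ℂ, AnalyticAt ℂ Y x₀ ∧
      ψ =ᶠ[𝓝[≠] x₀] fun x => (x - x₀) ^ (-M : ℤ) • Y x := by
    have hz : MeromorphicAt (fun x : ℂ => (x - x₀) ^ (M : ℤ)) x₀ := by fun_prop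
    have hmer := hz.smul hψ.meromorphicAt
    have h0 : 0 ≤ meromorphicOrderAt ((fun x : ℂ => (x - x₀) ^ (M : ℤ)) • ψ) x₀ := by
      rw [meromorphicOrderAt_smul hz hψ.meromorphicAt, fun_meromorphicOrderAt_zpow_id_sub_const]
      calc (0 : WithTop ℤ) = ((M : ℤ) : WithTop ℤ) + ((-(M : ℤ) : ℤ) : WithTop ℤ) := by
            rw [← WithTop.coe_add, add_neg_cancel]; rfl
        _ ≤ _ := by gcongr
    obtain ⟨Y, hY, h⟩ := hmer.meromorphicOrderAt_nonneg_iff.1 h0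
    refine ⟨Y, hY, ?_⟩
    filter_upwards [h, self_mem_nhdsWithin] with x hx hx0
    have hx0 : x - x₀ ≠ 0 := sub_ne_zero.2 hx0
    rw [← hx, Pi.smul_apply', smul_smul, ← zpow_add₀ hx0]
    simp
  choose v f hf hv using fun i => exists_eq_sum_add_pow_mul (analyticAt_pi_iff.1 hY i) (2 * M)
  obtain ⟨h, hfh⟩ : ∃ h : ℂ → ι → ℂ, ∀ i, f i = fun x => h x i := ⟨fun x i => f i x, fun i => rfl⟩
  have hY' : Y = fun x => jet x₀ (2 * M) v x + (x - x₀) ^ (2 * M) • h x := by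
    ext x i
    simpa [jet_apply, hfh] using hv i x
  have hha : AnalyticAt ℂ h x₀ :=
    analyticAt_pi_iff.2 fun i => by simpa only [hfh] using hf i
  refine ⟨v, h, hha, ?_, ?_⟩
  · rw [hY'] at hψY
    exact hψY
  · have hYd := hY.deriv
    have heq : (fun x => (x - x₀) • deriv Y x + ((-M : ℤ) : ℂ) • Y x) =ᶠ[𝓝 x₀]
        fun x => F x *ᵥ Y x := by
      refine eventuallyEq_nhds_of_analyticAt (by fun_prop) (analyticAt_mulVec hF hY) ?_
      filter_upwards [hψ.equation, eventually_deriv_zpow_smul_iff (F := F) hY hψY] with x h1 h2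
      exact h2.1 h1
    have hhd := hha.deriv
    refine ⟨fun x => F x *ᵥ h x - ((M : ℂ) • h x +
      (x - x₀) • deriv h x), ?_, ?_⟩
    · have := analyticAt_mulVec hF hha
      fun_prop
    · filter_upwards [heq, hha.eventually_analyticAt] with x hx hxa
      have hp : DifferentiableAt ℂ (fun x => (x - x₀) ^ (2 * M)) x := by fun_prop
      have e1 : deriv Y x = deriv (jet x₀ (2 * M) v) x +
          deriv (fun x => (x - x₀) ^ (2 * M) • h x) x := by
        rw [hY']
        exact deriv_fun_add (analyticAt_jet _ v x).differentiableAt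
          (hp.smul hxa.differentiableAt)
      rw [e1, smul_add, smul_deriv_jet, smul_deriv_pow_smul hxa] at hx
      simp only [hY', Matrix.mulVec_add, Matrix.mulVec_smul] at hx
      simp only [jetDefect, LinearMap.coe_mk, AddHom.coe_mk]
      rw [sub_eq_iff_eq_add, sub_eq_iff_eq_add]
      push_cast at hx
      linear_combination (norm := module) hx

/-- A polynomial solution of `z Y' = M Y + F Y` modulo `z ^ (2 M)` extends to a meromorphic
solution `z ^ (-M) Y` of `z ψ' = F ψ`: the correction `z ^ (2 M) y` solves an inhomogeneous
equation without resonances. -/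
theorem exists_isGermSolution_of_jetDefect_mem (hF : ∀ i j, AnalyticAt ℂ (fun x => F x i j) x₀)
    (hM : ∀ i, ∑ j, ‖F x₀ i j‖ + 1 ≤ M) (hM1 : 1 ≤ M) {v : ι → Fin (2 * M) → ℂ}
    (hv : jetDefect F x₀ M (2 * M) v ∈ vanishingGerms ι x₀ (2 * M)) :
    ∃ ψ h : ℂ → ι → ℂ, IsGermSolution (fun x => (x - x₀)⁻¹ • F x) x₀ ψ ∧ AnalyticAt ℂ h x₀ ∧
      ψ =ᶠ[𝓝[≠] x₀] fun x =>
        (x - x₀) ^ (-M : ℤ) • (jet x₀ (2 * M) v x + (x - x₀) ^ (2 * M) • h x) := by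
  obtain ⟨g, hg, hgv⟩ := hv
  obtain ⟨y, hy, hyeq⟩ := exists_analyticAt_singular_solution (h := fun x => -g x) hF
    (fun i => (analyticAt_pi_iff.1 hg i).neg) hM (by exact_mod_cast hM1)
  have hj := analyticAt_jet (x₀ := x₀) (2 * M) v x₀
  have hYa : AnalyticAt ℂ (fun x => jet x₀ (2 * M) v x + (x - x₀) ^ (2 * M) • y x) x₀ := by
    fun_prop
  refine ⟨fun x => (x - x₀) ^ (-M : ℤ) • (jet x₀ (2 * M) v x + (x - x₀) ^ (2 * M) • y x), y,
    ⟨MeromorphicAt.fun_smul (by fun_prop) hYa.meromorphicAt, ?_⟩, hy, EventuallyEq.rfl⟩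
  filter_upwards [eventually_deriv_zpow_smul_iff (F := F) hYa EventuallyEq.rfl,
    hyeq.filter_mono nhdsWithin_le_nhds, hgv.filter_mono nhdsWithin_le_nhds,
    hy.eventually_analyticAt.filter_mono nhdsWithin_le_nhds] with x h1 h2 h3 h4
  rw [h1]
  have hp : DifferentiableAt ℂ (fun x => (x - x₀) ^ (2 * M)) x := by fun_prop
  have e1 : deriv (fun x => jet x₀ (2 * M) v x + (x - x₀) ^ (2 * M) • y x) x =
      deriv (jet x₀ (2 * M) v) x + deriv (fun x => (x - x₀) ^ (2 * M) • y x) x :=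
    deriv_fun_add (analyticAt_jet _ v x).differentiableAt
      (hp.smul h4.differentiableAt)
  rw [e1, smul_add, smul_deriv_jet, smul_deriv_pow_smul h4]
  simp only [jetDefect, LinearMap.coe_mk, AddHom.coe_mk] at h3
  simp only [Matrix.mulVec_add, Matrix.mulVec_smul]
  push_cast at h2 ⊢
  linear_combination (norm := module) h3 + (x - x₀) ^ (2 * M) • h2

/-- A solution of `z ψ' = F ψ` that vanishes to high order vanishes. -/
theorem IsGermSolution.eventually_eq_zero (hF : ∀ i j, AnalyticAt ℂ (fun x => F x i j) x₀)
    (hM : ∀ i, ∑ j, ‖F x₀ i j‖ + 1 ≤ M) (hM1 : 1 ≤ M) {ψ h : ℂ → ι → ℂ}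
    (hψ : IsGermSolution (fun x => (x - x₀)⁻¹ • F x) x₀ ψ) (hh : AnalyticAt ℂ h x₀)
    (hψh : ψ =ᶠ[𝓝[≠] x₀] fun x => (x - x₀) ^ (-M : ℤ) • ((x - x₀) ^ (2 * M) • h x)) :
    ∀ᶠ x in 𝓝[≠] x₀, ψ x = 0 := by
  have hM1' : (1 : ℝ) ≤ M := by exact_mod_cast hM1
  rw [← meromorphicOrderAt_eq_top_iff]
  have hord : ((M : ℤ) : WithTop ℤ) ≤ meromorphicOrderAt ψ x₀ := by
    have h1 : ψ =ᶠ[𝓝[≠] x₀] (fun x : ℂ => (x - x₀) ^ (M : ℤ)) • h := by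
      filter_upwards [hψh, self_mem_nhdsWithin] with x hx hx0
      have hx0 : x - x₀ ≠ 0 := sub_ne_zero.2 hx0
      rw [hx, Pi.smul_apply', smul_smul, ← zpow_natCast, ← zpow_add₀ hx0]
      congr 2
      push_cast; ring
    rw [meromorphicOrderAt_congr h1, meromorphicOrderAt_smul (by fun_prop) hh.meromorphicAt,
      fun_meromorphicOrderAt_zpow_id_sub_const]
    exact le_add_of_nonneg_right hh.meromorphicOrderAt_nonneg
  cases hn : meromorphicOrderAt ψ x₀ with
  | top => rfl
  | coe n =>
    have h1 := abs_order_le (κ := M - 1) (by linarith) hF (fun i => by linarith [hM i]) hψ hn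
    have h2 : ((M : ℤ) : ℝ) ≤ n := by
      rw [hn] at hord
      exact_mod_cast hord
    have := le_abs_self (n : ℝ)
    push_cast at h2
    linarith

/-- The meromorphic solutions of `z ψ' = F ψ` correspond to the polynomial solutions of
`z Y' = M Y + F Y` modulo `z ^ (2 M)`, so independence can be tested on polynomials. -/
theorem hasTwoGermSolutions_iff_jet (hF : ∀ i j, AnalyticAt ℂ (fun x => F x i j) x₀)
    (hM : ∀ i, ∑ j, ‖F x₀ i j‖ + 1 ≤ M) (hM1 : 1 ≤ M) :
    HasTwoGermSolutions (fun x => (x - x₀)⁻¹ • F x) x₀ ↔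
      ∃ v : Fin 2 → ι → Fin (2 * M) → ℂ, LinearIndependent ℂ v ∧
        ∀ k, jetDefect F x₀ M (2 * M) (v k) ∈ vanishingGerms ι x₀ (2 * M) := by
  constructor
  · rintro ⟨ψ, hψ, hind⟩
    choose v h hh hψv hv using fun k => (hψ k).exists_jet hF hM hM1
    refine ⟨v, Fintype.linearIndependent_iff.2 fun c hc => ?_, hv⟩
    refine fun k => congrFun (hind c ?_) k
    refine (IsGermSolution.sum_smul hψ c).eventually_eq_zero hF hM hM1
      (h := fun x => ∑ k, c k • h k x)
      (Finset.analyticAt_fun_sum _ fun k _ => (hh k).fun_const_smul) ?_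
    filter_upwards [eventually_all.2 hψv] with x hx
    have hj : ∑ k, c k • jet x₀ (2 * M) (v k) x = 0 := by
      have := congrFun (congrArg (jet x₀ (2 * M)) hc) x
      simpa [map_sum] using this
    have : ∑ k, c k • ψ k x = (x - x₀) ^ (-M : ℤ) • (∑ k, c k • jet x₀ (2 * M) (v k) x +
        (x - x₀) ^ (2 * M) • ∑ k, c k • h k x) := by
      simp only [hx, Fin.sum_univ_two]
      module
    rw [this, hj, zero_add]
  · rintro ⟨v, hv, hvm⟩
    choose ψ h hψ hh hψv using fun k => exists_isGermSolution_of_jetDefect_mem hF hM hM1 (hvm k)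
    refine ⟨ψ, hψ, fun c hc => funext fun k => Fintype.linearIndependent_iff.1 hv c ?_ k⟩
    ext i : 1
    refine eq_zero_of_sum_eq_pow_mul (x₀ := x₀) (g := fun x => -(∑ k, c k • h k x) i) ?_ ?_
    · exact (analyticAt_pi_iff.1 (Finset.analyticAt_fun_sum _ fun k _ =>
        (hh k).fun_const_smul) i).neg
    · filter_upwards [hc, eventually_all.2 hψv, self_mem_nhdsWithin] with x h1 h2 hx0
      have hx0 : x - x₀ ≠ 0 := sub_ne_zero.2 hx0
      have h3 : (x - x₀) ^ (-M : ℤ) • (jet x₀ (2 * M) (∑ k, c k • v k) x +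
          (x - x₀) ^ (2 * M) • ∑ k, c k • h k x) = 0 := by
        rw [← h1]
        simp only [h2, Fin.sum_univ_two, map_add, map_smul, Pi.add_apply, Pi.smul_apply]
        module
      have h4 := congrFun ((smul_eq_zero_iff_right (zpow_ne_zero _ hx0)).1 h3) i
      rw [← jet_apply]
      simp only [Pi.add_apply, Pi.smul_apply, smul_eq_mul, Pi.zero_apply] at h4
      linear_combination h4

/-- For a system `z ψ' = (F + E z D) ψ`, the parameters `E` with two independent meromorphic
solutions at `x₀` are finite in number, or every `E` is such a parameter: the solutions correspond
to the kernel of a linear pencil in `E` on a finite-dimensional space of polynomials. -/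
theorem finite_setOf_hasTwoGermSolutions_or_forall
    (hF : ∀ i j, AnalyticAt ℂ (fun x => F x i j) x₀) (D : Matrix ι ι ℂ) :
    {E : ℂ | HasTwoGermSolutions
      (fun x => (x - x₀)⁻¹ • (F x + (E * (x - x₀)) • D)) x₀}.Finite ∨
      ∀ E : ℂ, HasTwoGermSolutions (fun x => (x - x₀)⁻¹ • (F x + (E * (x - x₀)) • D)) x₀ := by
  obtain ⟨M, hM⟩ := exists_nat_ge (∑ i, ∑ j, ‖F x₀ i j‖ + 1)
  have hM1 : 1 ≤ M := by
    have : 0 ≤ ∑ i, ∑ j, ‖F x₀ i j‖ :=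
      Finset.sum_nonneg fun i _ => Finset.sum_nonneg fun j _ => norm_nonneg _
    have : (1 : ℝ) ≤ M := by linarith
    exact_mod_cast this
  have hMi : ∀ E : ℂ, ∀ i, ∑ j, ‖(F x₀ + (E * (x₀ - x₀)) • D) i j‖ + 1 ≤ M := fun E i => by
    have := Finset.single_le_sum (f := fun i => ∑ j, ‖F x₀ i j‖)
      (fun i _ => Finset.sum_nonneg fun j _ => norm_nonneg _) (Finset.mem_univ i)
    simp only [sub_self, mul_zero, zero_smul, add_zero]
    linarith
  have hFE : ∀ E : ℂ, ∀ i j, AnalyticAt ℂ (fun x => (F x + (E * (x - x₀)) • D) i j) x₀ :=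
    fun E i j => by
      have := hF i j
      simp only [Matrix.add_apply, Matrix.smul_apply, smul_eq_mul]
      fun_prop
  let T : (ι → Fin (2 * M) → ℂ) →ₗ[ℂ] (ℂ → ι → ℂ) :=
    { toFun := fun v x => -(x - x₀) • (D *ᵥ jet x₀ (2 * M) v x)
      map_add' := fun v w => by
        ext x : 1
        simp only [map_add, Pi.add_apply, Matrix.mulVec_add, smul_add]
      map_smul' := fun c v => by
        ext x : 1
        simp only [map_smul, Pi.smul_apply, Matrix.mulVec_smul, RingHom.id_apply]
        exact smul_comm _ _ _ }
  have hiff : ∀ E : ℂ, HasTwoGermSolutions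
      (fun x => (x - x₀)⁻¹ • (F x + (E * (x - x₀)) • D)) x₀ ↔
      ∃ v : Fin 2 → ι → Fin (2 * M) → ℂ, LinearIndependent ℂ v ∧ ∀ k,
        ((vanishingGerms ι x₀ (2 * M)).mkQ ∘ₗ jetDefect F x₀ M (2 * M)) (v k) +
          E • ((vanishingGerms ι x₀ (2 * M)).mkQ ∘ₗ T) (v k) = 0 := fun E => by
    rw [hasTwoGermSolutions_iff_jet (hFE E) (hMi E) hM1]
    refine exists_congr fun v => and_congr_right fun _ => forall_congr' fun k => ?_
    rw [LinearMap.comp_apply, LinearMap.comp_apply, ← map_smul, ← map_add,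
      Submodule.mkQ_apply, Submodule.Quotient.mk_eq_zero]
    have : jetDefect (fun x => F x + (E * (x - x₀)) • D) x₀ M (2 * M) (v k) =
        jetDefect F x₀ M (2 * M) (v k) + E • T (v k) := by
      ext x : 1
      simp only [jetDefect, T, LinearMap.coe_mk, AddHom.coe_mk, Pi.add_apply, Pi.smul_apply,
        Matrix.add_mulVec, Matrix.smul_mulVec]
      module
    rw [this]
  simp only [hiff]
  exact finite_setOf_two_le_ker_or_forall _ _

end Germs

/-! ### Reduction of the equation to a singularity of the first kind -/

section Local

variable {x₀ : ℂ} {p q : ℂ → ℂ}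

/-- The coefficient matrix of `J ψ' + Q ψ = E ψ` written as `ψ' = A ψ`. -/
def coeffMatrix (p q : ℂ → ℂ) (E x : ℂ) : Matrix (Fin 2) (Fin 2) ℂ :=
  !![-Complex.I * E, q x; p x, Complex.I * E]

theorem J_mulVec_add_eq_iff (E x : ℂ) (v w : Fin 2 → ℂ) :
    J *ᵥ w + Q p q x *ᵥ v = E • v ↔ w = coeffMatrix p q E x *ᵥ v := by
  have hI := Complex.I_mul_I
  simp only [funext_iff, Fin.forall_fin_two, J, Q, coeffMatrix, Pi.add_apply, Pi.smul_apply,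
    Matrix.mulVec, dotProduct, Fin.sum_univ_two, Matrix.of_apply, Matrix.cons_val_zero,
    Matrix.cons_val_one, smul_eq_mul]
  refine and_congr ⟨fun h => ?_, fun h => ?_⟩ ⟨fun h => ?_, fun h => ?_⟩
  · linear_combination (-Complex.I) * h + (w 0 - q x * v 1) * hI
  · linear_combination Complex.I * h + (-(E * v 0)) * hI
  · linear_combination Complex.I * h + (w 1 - p x * v 0) * hI
  · linear_combination (-Complex.I) * h + (-(E * v 1)) * hI

theorem meromorphicAt_pi_iff {ι : Type*} [Fintype ι] {ψ : ℂ → ι → ℂ} :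
    MeromorphicAt ψ x₀ ↔ ∀ i, MeromorphicAt (fun x => ψ x i) x₀ := by
  classical
  constructor
  · rintro ⟨n, hn⟩ i
    exact ⟨n, analyticAt_pi_iff.1 hn i⟩
  · intro h
    have : ψ = fun x => ∑ i, ψ x i • (Pi.single i 1 : ι → ℂ) := by
      ext x j
      simp [Finset.sum_apply, Pi.single_apply]
    rw [this]
    exact MeromorphicAt.fun_sum fun i _ => (h i).fun_smul (MeromorphicAt.const _ _)

theorem IsGermSolution.eventually_deriv_apply {ι : Type*} [Fintype ι]
    {A : ℂ → Matrix ι ι ℂ} {ψ : ℂ → ι → ℂ} (h : IsGermSolution A x₀ ψ) :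
    ∀ᶠ x in 𝓝[≠] x₀, ∀ i, HasDerivAt (fun x => ψ x i) ((A x *ᵥ ψ x) i) x := by
  filter_upwards [h.equation, h.meromorphicAt.eventually_analyticAt] with x h1 h2 i
  have := h2.differentiableAt.hasDerivAt
  rw [h1, hasDerivAt_pi] at this
  exact this i

theorem isGermSolution_of_eventually_hasDerivAt {ι : Type*} [Fintype ι]
    {A : ℂ → Matrix ι ι ℂ} {ψ : ℂ → ι → ℂ} (hm : ∀ i, MeromorphicAt (fun x => ψ x i) x₀)
    (h : ∀ᶠ x in 𝓝[≠] x₀, ∀ i, HasDerivAt (fun x => ψ x i) ((A x *ᵥ ψ x) i) x) :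
    IsGermSolution A x₀ ψ := by
  refine ⟨meromorphicAt_pi_iff.2 hm, ?_⟩
  filter_upwards [h] with x hx
  exact (hasDerivAt_pi.2 hx).deriv

/-- The shearing transformation `diag(1, z ^ d)`, with `z = x - x₀`. -/
noncomputable def shear (x₀ : ℂ) (d : ℤ) (ψ : ℂ → Fin 2 → ℂ) (x : ℂ) : Fin 2 → ℂ :=
  ![ψ x 0, (x - x₀) ^ d * ψ x 1]

/-- The coefficient matrix of the system satisfied by `shear x₀ d ψ` when `ψ' = A ψ`. -/
noncomputable def shearMatrix (x₀ : ℂ) (d : ℤ) (A : ℂ → Matrix (Fin 2) (Fin 2) ℂ) (x : ℂ) :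
    Matrix (Fin 2) (Fin 2) ℂ :=
  !![A x 0 0, (x - x₀) ^ (-d) * A x 0 1; (x - x₀) ^ d * A x 1 0, A x 1 1 + d * (x - x₀)⁻¹]

theorem IsGermSolution.shear {A : ℂ → Matrix (Fin 2) (Fin 2) ℂ} {ψ : ℂ → Fin 2 → ℂ}
    (h : IsGermSolution A x₀ ψ) (d : ℤ) :
    IsGermSolution (shearMatrix x₀ d A) x₀ (shear x₀ d ψ) := by
  have hm := meromorphicAt_pi_iff.1 h.meromorphicAt
  refine isGermSolution_of_eventually_hasDerivAt (Fin.forall_fin_two.2 ⟨hm 0, ?_⟩) ?_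
  · exact MeromorphicAt.fun_mul (by fun_prop) (hm 1)
  · filter_upwards [h.eventually_deriv_apply, self_mem_nhdsWithin] with x hx hx0
    have h0 : x - x₀ ≠ 0 := sub_ne_zero.2 hx0
    have hz : HasDerivAt (fun x => (x - x₀) ^ d) (d * (x - x₀) ^ (d - 1)) x :=
      (hasDerivAt_zpow d (x - x₀) (Or.inl h0)).comp_sub_const x x₀
    refine Fin.forall_fin_two.2 ⟨?_, ?_⟩
    · refine (hx 0).congr_deriv ?_
      simp only [AKNS.shear, shearMatrix, Matrix.mulVec, dotProduct, Fin.sum_univ_two,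
        Matrix.of_apply, Matrix.cons_val_zero, Matrix.cons_val_one, zpow_neg]
      field_simp
    · refine (hz.mul (hx 1)).congr_deriv ?_
      simp only [AKNS.shear, shearMatrix, Matrix.mulVec, dotProduct, Fin.sum_univ_two,
        Matrix.of_apply, Matrix.cons_val_zero, Matrix.cons_val_one, zpow_sub_one₀ h0]
      ring

theorem HasTwoGermSolutions.shear {A : ℂ → Matrix (Fin 2) (Fin 2) ℂ}
    (h : HasTwoGermSolutions A x₀) (d : ℤ) : HasTwoGermSolutions (shearMatrix x₀ d A) x₀ := by
  obtain ⟨ψ, hψ, hind⟩ := h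
  refine ⟨fun k => AKNS.shear x₀ d (ψ k), fun k => (hψ k).shear d, fun c hc => hind c ?_⟩
  filter_upwards [hc, self_mem_nhdsWithin] with x hx hx0
  have h0 : (x - x₀) ^ d ≠ 0 := zpow_ne_zero _ (sub_ne_zero.2 hx0)
  simp only [AKNS.shear, funext_iff, Fin.forall_fin_two, Fin.sum_univ_two, Pi.add_apply,
    Pi.smul_apply, smul_eq_mul, Pi.zero_apply, Matrix.cons_val_zero, Matrix.cons_val_one] at hx ⊢
  refine ⟨hx.1, ?_⟩
  have : (x - x₀) ^ d * (c 0 * ψ 0 x 1 + c 1 * ψ 1 x 1) = 0 := by linear_combination hx.2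
  exact (mul_eq_zero.1 this).resolve_left h0

theorem sub_one_le_meromorphicOrderAt_deriv {u : ℂ → ℂ} {m : ℤ} (hu : MeromorphicAt u x₀)
    (hm : meromorphicOrderAt u x₀ = m) :
    ((m - 1 : ℤ) : WithTop ℤ) ≤ meromorphicOrderAt (deriv u) x₀ := by
  rcases eq_or_ne m 0 with rfl | hm0
  · obtain ⟨g, hg, hug⟩ := hu.meromorphicOrderAt_nonneg_iff.1 (by rw [hm]; rfl)
    have : deriv u =ᶠ[𝓝[≠] x₀] deriv g :=
      (eventually_eventuallyEq_nhds hug).mono fun x hx => hx.deriv_eq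
    rw [meromorphicOrderAt_congr this]
    exact le_trans (by exact_mod_cast (by norm_num : (0 - 1 : ℤ) ≤ 0))
      hg.deriv.meromorphicOrderAt_nonneg
  · rw [meromorphicOrderAt_deriv_eq_sub_one (by exact_mod_cast hm0) hm]

/-- If `u' + a u = q v` with `u, v` nonzero then `q` has a pole of order at most
`ord v - ord u + 1`. -/
theorem le_order_of_deriv_add_eq {u v : ℂ → ℂ} (a : ℂ) (hu : MeromorphicAt u x₀)
    (hv : MeromorphicAt v x₀) (hq : MeromorphicAt q x₀) {m n : ℤ}
    (hm : meromorphicOrderAt u x₀ = m) (hn : meromorphicOrderAt v x₀ = n)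
    (h : ∀ᶠ x in 𝓝[≠] x₀, deriv u x + a * u x = q x * v x) :
    ((m - n - 1 : ℤ) : WithTop ℤ) ≤ meromorphicOrderAt q x₀ := by
  have h1 : meromorphicOrderAt (deriv u + (fun _ => a) * u) x₀ = meromorphicOrderAt (q * v) x₀ :=
    meromorphicOrderAt_congr h
  have h2 : ((m - 1 : ℤ) : WithTop ℤ) ≤ meromorphicOrderAt (q * v) x₀ := by
    rw [← h1]
    refine le_trans (le_min (sub_one_le_meromorphicOrderAt_deriv hu hm) ?_)
      (meromorphicOrderAt_add hu.deriv ((MeromorphicAt.const a x₀).mul hu))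
    rw [meromorphicOrderAt_mul (MeromorphicAt.const a x₀) hu, hm]
    have h0 : 0 ≤ meromorphicOrderAt (fun _ : ℂ => a) x₀ :=
      analyticAt_const.meromorphicOrderAt_nonneg
    refine le_trans ?_ (le_add_of_nonneg_left h0)
    exact_mod_cast (by lia : m - 1 ≤ m)
  rw [meromorphicOrderAt_mul hq hv, hn] at h2
  cases hb : meromorphicOrderAt q x₀ with
  | top => exact le_top
  | coe b =>
    rw [hb] at h2
    have h3 : m - 1 ≤ b + n := by exact_mod_cast h2
    exact_mod_cast (by lia : m - n - 1 ≤ b)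

/-- If `u' + a u = q v` with `u` zero and `v` nonzero then `q` is zero. -/
theorem order_eq_top_of_deriv_add_eq {u v : ℂ → ℂ} (a : ℂ) (hv : MeromorphicAt v x₀)
    (hq : MeromorphicAt q x₀) (hm : meromorphicOrderAt u x₀ = ⊤)
    (hn : meromorphicOrderAt v x₀ ≠ ⊤)
    (h : ∀ᶠ x in 𝓝[≠] x₀, deriv u x + a * u x = q x * v x) : meromorphicOrderAt q x₀ = ⊤ := by
  have h0 : u =ᶠ[𝓝[≠] x₀] 0 := meromorphicOrderAt_eq_top_iff.1 hm
  have h1 : meromorphicOrderAt (q * v) x₀ = ⊤ := by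
    rw [meromorphicOrderAt_eq_top_iff]
    filter_upwards [h, h0, eventually_eventuallyEq_nhds h0] with x hx hx0 hx1
    rw [Pi.mul_apply, ← hx, hx0, hx1.deriv_eq]
    simp
  rw [meromorphicOrderAt_mul hq hv, WithTop.add_eq_top] at h1
  exact h1.resolve_right hn

/-- A single nonzero meromorphic solution bounds the poles of `p` and `q` in such a way that a
shearing transformation removes all but a simple pole of the coefficient matrix. -/
theorem exists_shear_exponent (hp : MeromorphicAt p x₀) (hq : MeromorphicAt q x₀) {E : ℂ}
    {ψ : ℂ → Fin 2 → ℂ} (hψ : IsGermSolution (coeffMatrix p q E) x₀ ψ)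
    (hψ0 : ¬ ∀ᶠ x in 𝓝[≠] x₀, ψ x = 0) :
    ∃ d : ℤ, ((-(d + 1) : ℤ) : WithTop ℤ) ≤ meromorphicOrderAt q x₀ ∧
      ((d - 1 : ℤ) : WithTop ℤ) ≤ meromorphicOrderAt p x₀ := by
  have hm := meromorphicAt_pi_iff.1 hψ.meromorphicAt
  have hu := hm 0
  have hv := hm 1
  have e0 : ∀ᶠ x in 𝓝[≠] x₀, deriv (fun x => ψ x 0) x + Complex.I * E * ψ x 0 = q x * ψ x 1 := by
    filter_upwards [hψ.eventually_deriv_apply] with x hx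
    rw [(hx 0).deriv]
    simp [coeffMatrix, Matrix.mulVec, dotProduct, Fin.sum_univ_two]
  have e1 : ∀ᶠ x in 𝓝[≠] x₀, deriv (fun x => ψ x 1) x + -Complex.I * E * ψ x 1 =
      p x * ψ x 0 := by
    filter_upwards [hψ.eventually_deriv_apply] with x hx
    rw [(hx 1).deriv]
    simp [coeffMatrix, Matrix.mulVec, dotProduct, Fin.sum_univ_two]
  cases h0 : meromorphicOrderAt (fun x => ψ x 0) x₀ with
  | top =>
    have h1 : meromorphicOrderAt (fun x => ψ x 1) x₀ ≠ ⊤ := fun h1 => hψ0 <| by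
      filter_upwards [meromorphicOrderAt_eq_top_iff.1 h0, meromorphicOrderAt_eq_top_iff.1 h1]
        with x hx0 hx1
      ext i
      fin_cases i
      · exact hx0
      · exact hx1
    rw [order_eq_top_of_deriv_add_eq _ hv hq h0 h1 e0]
    cases ha : meromorphicOrderAt p x₀ with
    | top => exact ⟨0, le_top, le_top⟩
    | coe a => exact ⟨a + 1, le_top, by rw [add_sub_cancel_right]⟩
  | coe m =>
    cases h1 : meromorphicOrderAt (fun x => ψ x 1) x₀ with
    | top =>
      rw [order_eq_top_of_deriv_add_eq _ hu hp h1 (by rw [h0]; exact WithTop.coe_ne_top) e1]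
      cases hb : meromorphicOrderAt q x₀ with
      | top => exact ⟨0, le_top, le_top⟩
      | coe b => exact ⟨-b - 1, by rw [show -(-b - 1 + 1) = b by ring], le_top⟩
    | coe n =>
      refine ⟨n - m, ?_, le_order_of_deriv_add_eq _ hv hu hp h1 h0 e1⟩
      rw [show -(n - m + 1) = m - n - 1 by ring]
      exact le_order_of_deriv_add_eq _ hu hv hq h0 h1 e0

theorem exists_analyticAt_eq_zpow_mul (hq : MeromorphicAt q x₀) {n : ℤ}
    (hn : ((-n : ℤ) : WithTop ℤ) ≤ meromorphicOrderAt q x₀) :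
    ∃ f, AnalyticAt ℂ f x₀ ∧ ∀ᶠ x in 𝓝[≠] x₀, (x - x₀) ^ n * q x = f x := by
  have hz : MeromorphicAt (fun x : ℂ => (x - x₀) ^ n) x₀ := by fun_prop
  refine (hz.fun_mul hq).meromorphicOrderAt_nonneg_iff.1 ?_
  rw [fun_meromorphicOrderAt_mul hz hq, fun_meromorphicOrderAt_zpow_id_sub_const]
  calc (0 : WithTop ℤ) = (n : WithTop ℤ) + ((-n : ℤ) : WithTop ℤ) := by
        rw [← WithTop.coe_add, add_neg_cancel]; rfl
    _ ≤ _ := by gcongr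

/-- At each point, either finitely many `E` or all `E` admit a local meromorphic fundamental
system. -/
theorem finite_setOf_hasTwoGermSolutions_coeffMatrix_or_forall (hp : MeromorphicAt p x₀)
    (hq : MeromorphicAt q x₀) :
    {E : ℂ | HasTwoGermSolutions (coeffMatrix p q E) x₀}.Finite ∨
      ∀ E : ℂ, HasTwoGermSolutions (coeffMatrix p q E) x₀ := by
  by_cases hne : ∃ E, HasTwoGermSolutions (coeffMatrix p q E) x₀
  swap
  · left
    push Not at hne
    simp [hne]
  obtain ⟨E₀, ψ, hψ, hind⟩ := hne
  obtain ⟨d, hdq, hdp⟩ := exists_shear_exponent hp hq (hψ 0) fun h0 => by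
    have := congrFun (hind ![1, 0] (by simpa using h0)) 0
    simp at this
  obtain ⟨f, hf, hqf⟩ := exists_analyticAt_eq_zpow_mul hq hdq
  obtain ⟨g, hg, hpg⟩ := exists_analyticAt_eq_zpow_mul (n := 1 - d) hp (by rwa [neg_sub])
  let F : ℂ → Matrix (Fin 2) (Fin 2) ℂ := fun x => !![0, f x; g x, -d]
  let D : Matrix (Fin 2) (Fin 2) ℂ := !![-Complex.I, 0; 0, Complex.I]
  have hF : ∀ i j, AnalyticAt ℂ (fun x => F x i j) x₀ := by
    intro i j
    fin_cases i <;> fin_cases j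
    · exact analyticAt_const
    · exact hf
    · exact hg
    · exact analyticAt_const
  have hiff : ∀ E, HasTwoGermSolutions (coeffMatrix p q E) x₀ ↔
      HasTwoGermSolutions (fun x => (x - x₀)⁻¹ • (F x + (E * (x - x₀)) • D)) x₀ := fun E => by
    constructor
    · intro h
      refine (h.shear (-d)).congr ?_
      filter_upwards [hqf, hpg, self_mem_nhdsWithin] with x h1 h2 hx0
      have h0 : x - x₀ ≠ 0 := sub_ne_zero.2 hx0
      rw [zpow_add_one₀ h0] at h1
      rw [sub_eq_add_neg (1 : ℤ), zpow_add₀ h0, zpow_one] at h2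
      ext i j
      fin_cases i <;> fin_cases j <;>
        simp [shearMatrix, coeffMatrix, F, D, ← h1, ← h2] <;> field_simp
      ring
    · intro h
      refine (h.shear d).congr ?_
      filter_upwards [hqf, hpg, self_mem_nhdsWithin] with x h1 h2 hx0
      have h0 : x - x₀ ≠ 0 := sub_ne_zero.2 hx0
      rw [zpow_add_one₀ h0] at h1
      rw [sub_eq_add_neg (1 : ℤ), zpow_add₀ h0, zpow_one, zpow_neg] at h2
      ext i j
      fin_cases i <;> fin_cases j <;>
        simp [shearMatrix, coeffMatrix, F, D, ← h1, ← h2] <;> field_simp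
      ring
  simp only [hiff]
  exact finite_setOf_hasTwoGermSolutions_or_forall hF D

end Local

/-! ### Continuation of meromorphic germs in the plane -/

section Continuation

variable {X : Type*} [NormedAddCommGroup X] [NormedSpace ℂ X]

theorem eventuallyEq_of_isPreconnected {f g : ℂ → X} {U : Set ℂ} (hf : MeromorphicOn f U)
    (hg : MeromorphicOn g U) (hU : IsPreconnected U) {x y : ℂ} (hx : x ∈ U) (hy : y ∈ U)
    (h : f =ᶠ[𝓝[≠] x] g) : f =ᶠ[𝓝[≠] y] g := by
  have htop : ∀ {z}, meromorphicOrderAt (f - g) z = ⊤ ↔ f =ᶠ[𝓝[≠] z] g := fun {z} => by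
    rw [meromorphicOrderAt_eq_top_iff]
    exact eventually_congr (Eventually.of_forall fun w => sub_eq_zero)
  by_contra hne
  exact (hf.sub hg).meromorphicOrderAt_ne_top_of_isPreconnected hU hy hx (mt htop.1 hne)
    (htop.2 h)

/-- Gluing of meromorphic functions that agree on overlaps up to closed discrete sets. Values in
normal form make the agreement exact. -/
theorem exists_glue {κ : Type*} {U : κ → Set ℂ} {f : κ → ℂ → X} (hU : ∀ i, IsOpen (U i))
    (hf : ∀ i, MeromorphicOn (f i) (U i))
    (h : ∀ i j, ∀ x ∈ U i ∩ U j, f i =ᶠ[𝓝[≠] x] f j) :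
    ∃ g : ℂ → X, ∀ i, ∀ x ∈ U i, g =ᶠ[𝓝[≠] x] f i := by
  classical
  let g : ℂ → X := fun x =>
    if hx : ∃ i, x ∈ U i then toMeromorphicNFAt (f hx.choose) x x else 0
  refine ⟨g, fun i x hx => ?_⟩
  have hg : ∀ y ∈ U i, g y = toMeromorphicNFOn (f i) (U i) y := fun y hy => by
    have hy' : ∃ i, y ∈ U i := ⟨i, hy⟩
    rw [toMeromorphicNFOn_eq_toMeromorphicNFAt (hf i) hy]
    simp only [g, dif_pos hy']
    exact (toMeromorphicNFAt_eventuallyEq_nhds_congr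
      (h _ i y ⟨hy'.choose_spec, hy⟩)).eq_of_nhds
  filter_upwards [mem_nhdsWithin_of_mem_nhds ((hU i).mem_nhds hx),
    (hf i).toMeromorphicNFOn_eq_self_on_nhdsNE hx] with y hy hy'
  rw [hg y hy, ← hy']

variable {P : (ℂ → X) → ℂ → Prop} (hmer : ∀ f x, P f x → MeromorphicAt f x)
  (hcongr : ∀ f g x, P f x → f =ᶠ[𝓝[≠] x] g → P g x)
  (hloc : ∀ x, ∃ r > 0, ∀ y ∈ Metric.ball x r, ∀ f, P f y →
    ∃ g, (∀ z ∈ Metric.ball x r, P g z) ∧ g =ᶠ[𝓝[≠] y] f)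

include hmer hcongr hloc

/-- Small discs centred at the points of a closed disc continue the germ to a larger disc: where
two of them meet, they also meet the open disc. -/
theorem exists_continuation_larger_ball {R : ℝ} (hR : 0 < R) {f : ℂ → X}
    (hf : ∀ z ∈ Metric.ball (0 : ℂ) R, P f z) :
    ∃ δ > 0, ∃ g, (∀ z ∈ Metric.ball (0 : ℂ) (R + δ), P g z) ∧ g =ᶠ[𝓝[≠] 0] f := by
  choose r hr hext using hloc
  obtain ⟨δ, hδ, hleb⟩ := lebesgue_number_lemma_of_metric (isCompact_closedBall (0 : ℂ) R)
    (fun x => Metric.isOpen_ball (x := x) (ε := r x))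
    (fun x _ => Set.mem_iUnion.2 ⟨x, Metric.mem_ball_self (hr x)⟩)
  have hcl : closure (Metric.ball (0 : ℂ) R) = Metric.closedBall 0 R := closure_ball 0 hR.ne'
  have hK : ∀ x : Metric.closedBall (0 : ℂ) R, ∃ h, (∀ z ∈ Metric.ball (x : ℂ) δ, P h z) ∧
      ∀ z ∈ Metric.ball (x : ℂ) δ ∩ Metric.ball 0 R, h =ᶠ[𝓝[≠] z] f := by
    rintro ⟨x, hx⟩
    obtain ⟨x', hx'⟩ := hleb x hx
    rw [← hcl] at hx
    obtain ⟨y, hyx, hyR⟩ := mem_closure_iff.1 hx _ Metric.isOpen_ball (Metric.mem_ball_self hδ)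
    obtain ⟨h, hh, hhf⟩ := hext x' y (hx' hyx) f (hf y hyR)
    refine ⟨h, fun z hz => hh z (hx' hz), fun z hz => ?_⟩
    exact eventuallyEq_of_isPreconnected (U := Metric.ball x δ ∩ Metric.ball 0 R)
      (fun w hw => hmer _ _ (hh w (hx' hw.1))) (fun w hw => hmer _ _ (hf w hw.2))
      ((convex_ball x δ).inter (convex_ball 0 R)).isPreconnected ⟨hyx, hyR⟩ hz hhf
  choose h hh hhf using hK
  obtain ⟨g, hg⟩ := exists_glue (U := fun x : Metric.closedBall (0 : ℂ) R => Metric.ball (x : ℂ) δ)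
    (f := h) (fun x => Metric.isOpen_ball) (fun x z hz => hmer _ _ (hh x z hz)) (by
      rintro ⟨x, hx⟩ ⟨y, hy⟩ z ⟨hzx, hzy⟩
      -- the midpoint of the centres lies in both small discs and in the closed disc
      have hm : midpoint ℝ x y ∈ Metric.closedBall (0 : ℂ) R :=
        (convex_closedBall (0 : ℂ) R).midpoint_mem hx hy
      have hxy : dist x y < 2 * δ := by
        have := dist_triangle_right x y z
        rw [Metric.mem_ball, dist_comm] at hzx hzy
        linarith
      have hmx : midpoint ℝ x y ∈ Metric.ball x δ := by
        rw [Metric.mem_ball, dist_midpoint_left, Real.norm_eq_abs]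
        rw [abs_of_pos two_pos]
        linarith
      have hmy : midpoint ℝ x y ∈ Metric.ball y δ := by
        rw [Metric.mem_ball, dist_midpoint_right, Real.norm_eq_abs]
        rw [abs_of_pos two_pos]
        linarith
      rw [← hcl] at hm
      obtain ⟨w, hw, hwR⟩ := mem_closure_iff.1 hm _
        (Metric.isOpen_ball.inter Metric.isOpen_ball) ⟨hmx, hmy⟩
      exact eventuallyEq_of_isPreconnected (U := Metric.ball x δ ∩ Metric.ball y δ)
        (fun u hu => hmer _ _ (hh ⟨x, hx⟩ u hu.1)) (fun u hu => hmer _ _ (hh ⟨y, hy⟩ u hu.2))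
        ((convex_ball x δ).inter (convex_ball y δ)).isPreconnected hw ⟨hzx, hzy⟩
        ((hhf ⟨x, hx⟩ w ⟨hw.1, hwR⟩).trans (hhf ⟨y, hy⟩ w ⟨hw.2, hwR⟩).symm))
  refine ⟨δ, hδ, g, fun z hz => ?_, ?_⟩
  · rw [add_comm, ← thickening_closedBall hδ hR.le, Metric.mem_thickening_iff] at hz
    obtain ⟨x, hx, hzx⟩ := hz
    exact hcongr _ _ _ (hh ⟨x, hx⟩ z hzx) (hg ⟨x, hx⟩ z hzx).symm
  · have h0 : (0 : ℂ) ∈ Metric.closedBall (0 : ℂ) R := Metric.mem_closedBall_self hR.le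
    exact (hg ⟨0, h0⟩ 0 (Metric.mem_ball_self hδ)).trans
      (hhf ⟨0, h0⟩ 0 ⟨Metric.mem_ball_self hδ, Metric.mem_ball_self hR⟩)

/-- Monodromy principle for the plane: if every point has a disc on which germs with the local
property `P` continue, then every germ at `0` with the property `P` continues to the plane. -/
theorem exists_continuation {f : ℂ → X} (hf : P f 0) :
    ∃ g, (∀ z, P g z) ∧ g =ᶠ[𝓝[≠] 0] f := by
  let S : Set ℝ := {R | 0 < R ∧ ∃ g, (∀ z ∈ Metric.ball (0 : ℂ) R, P g z) ∧ g =ᶠ[𝓝[≠] 0] f}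
  have hS : ∀ R : S, ∃ g, (∀ z ∈ Metric.ball (0 : ℂ) R, P g z) ∧ g =ᶠ[𝓝[≠] 0] f :=
    fun R => R.2.2
  choose h hh hhf using hS
  obtain ⟨g, hg⟩ := exists_glue (U := fun R : S => Metric.ball (0 : ℂ) R) (f := h)
    (fun R => Metric.isOpen_ball) (fun R z hz => hmer _ _ (hh R z hz)) (by
      rintro R R' z ⟨hz, hz'⟩
      exact eventuallyEq_of_isPreconnected (U := Metric.ball (0 : ℂ) R ∩ Metric.ball 0 R')
        (fun u hu => hmer _ _ (hh R u hu.1)) (fun u hu => hmer _ _ (hh R' u hu.2))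
        ((convex_ball _ _).inter (convex_ball _ _)).isPreconnected
        ⟨Metric.mem_ball_self R.2.1, Metric.mem_ball_self R'.2.1⟩ ⟨hz, hz'⟩
        ((hhf R).trans (hhf R').symm))
  have hgP : ∀ R ∈ S, ∀ z ∈ Metric.ball (0 : ℂ) R, P g z := fun R hR z hz =>
    hcongr _ _ _ (hh ⟨R, hR⟩ z hz) (hg ⟨R, hR⟩ z hz).symm
  obtain ⟨r, hr, hext⟩ := hloc 0
  have hrS : r ∈ S := ⟨hr, hext 0 (Metric.mem_ball_self hr) f hf⟩
  have hgf : g =ᶠ[𝓝[≠] 0] f := (hg ⟨r, hrS⟩ 0 (Metric.mem_ball_self hr)).trans (hhf ⟨r, hrS⟩)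
  refine ⟨g, fun z => ?_, hgf⟩
  by_cases hb : BddAbove S
  · exfalso
    have hpos : 0 < sSup S := hr.trans_le (le_csSup hb hrS)
    have hgS : ∀ z ∈ Metric.ball (0 : ℂ) (sSup S), P g z := fun z hz => by
      rw [Metric.mem_ball] at hz
      obtain ⟨R, hR, hzR⟩ := exists_lt_of_lt_csSup ⟨r, hrS⟩ hz
      exact hgP R hR z hzR
    obtain ⟨δ, hδ, g', hg', hgg'⟩ := exists_continuation_larger_ball hmer hcongr hloc hpos hgS
    have := le_csSup hb (show sSup S + δ ∈ S from ⟨by linarith, g', hg', hgg'.trans hgf⟩)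
    linarith
  · obtain ⟨R, hR, hzR⟩ := not_bddAbove_iff.1 hb (dist z 0)
    exact hgP R hR z hzR

end Continuation

/-! ### The Wronskian and local continuation of solutions -/

section Wronskian

variable {x₀ : ℂ} {A : ℂ → Matrix (Fin 2) (Fin 2) ℂ}

theorem exists_eventually_eq_const_of_deriv_eq_zero {w : ℂ → ℂ} (hw : MeromorphicAt w x₀)
    (h : ∀ᶠ x in 𝓝[≠] x₀, HasDerivAt w 0 x) : ∃ c, ∀ᶠ x in 𝓝[≠] x₀, w x = c := by
  -- `c` is chosen so that `w - c` does not have order zero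
  obtain ⟨c, hc⟩ : ∃ c, meromorphicOrderAt (fun x => w x - c) x₀ ≠ 0 := by
    by_cases h0 : meromorphicOrderAt w x₀ = 0
    · obtain ⟨c, -, hc⟩ := tendsto_ne_zero_of_meromorphicOrderAt_eq_zero hw h0
      refine ⟨c, ne_of_gt ?_⟩
      rw [← tendsto_zero_iff_meromorphicOrderAt_pos (hw.fun_sub (MeromorphicAt.const c x₀))]
      simpa using hc.sub_const c
    · exact ⟨0, by simpa using h0⟩
  refine ⟨c, ?_⟩
  have htop : meromorphicOrderAt (fun x => w x - c) x₀ = ⊤ := by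
    cases hn : meromorphicOrderAt (fun x => w x - c) x₀ with
    | top => rfl
    | coe n =>
      have hn0 : (n : ℂ) ≠ 0 := by
        rintro h0
        rw [hn] at hc
        exact hc (by exact_mod_cast h0)
      have h1 := meromorphicOrderAt_deriv_eq_sub_one hn0 hn
      have h2 : meromorphicOrderAt (deriv fun x => w x - c) x₀ = ⊤ := by
        rw [meromorphicOrderAt_eq_top_iff]
        filter_upwards [h] with x hx
        exact (hx.sub_const c).deriv
      rw [h2] at h1
      exact absurd h1 WithTop.top_ne_coe
  filter_upwards [meromorphicOrderAt_eq_top_iff.1 htop] with x hx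
  exact sub_eq_zero.1 hx

/-- The Wronskian determinant of two vector functions. -/
def wronskian (φ ψ : ℂ → Fin 2 → ℂ) (x : ℂ) : ℂ :=
  φ x 0 * ψ x 1 - φ x 1 * ψ x 0

/-- Liouville's formula: for a traceless system the Wronskian of two solutions is constant. -/
theorem exists_eventually_wronskian_eq (hA : ∀ x, A x 0 0 + A x 1 1 = 0) {φ ψ : ℂ → Fin 2 → ℂ}
    (hφ : IsGermSolution A x₀ φ) (hψ : IsGermSolution A x₀ ψ) :
    ∃ c, ∀ᶠ x in 𝓝[≠] x₀, wronskian φ ψ x = c := by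
  have h1 := meromorphicAt_pi_iff.1 hφ.meromorphicAt
  have h2 := meromorphicAt_pi_iff.1 hψ.meromorphicAt
  refine exists_eventually_eq_const_of_deriv_eq_zero
    (((h1 0).fun_mul (h2 1)).fun_sub ((h1 1).fun_mul (h2 0))) ?_
  filter_upwards [hφ.eventually_deriv_apply, hψ.eventually_deriv_apply] with x h1 h2
  refine (((h1 0).mul (h2 1)).sub ((h1 1).mul (h2 0))).congr_deriv ?_
  simp only [Matrix.mulVec, dotProduct, Fin.sum_univ_two]
  linear_combination (φ x 0 * ψ x 1 - φ x 1 * ψ x 0) * hA x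

/-- Two meromorphic solutions with vanishing Wronskian are linearly dependent over `ℂ`. -/
theorem exists_eventually_eq_smul_of_wronskian_eq_zero {φ ψ : ℂ → Fin 2 → ℂ}
    (hφ : IsGermSolution A x₀ φ) (hψ : IsGermSolution A x₀ ψ)
    (hφ0 : ¬ ∀ᶠ x in 𝓝[≠] x₀, φ x = 0) (hw : ∀ᶠ x in 𝓝[≠] x₀, wronskian φ ψ x = 0) :
    ∃ c : ℂ, ∀ᶠ x in 𝓝[≠] x₀, ψ x = c • φ x := by
  have h1 := meromorphicAt_pi_iff.1 hφ.meromorphicAt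
  have h2 := meromorphicAt_pi_iff.1 hψ.meromorphicAt
  obtain ⟨i, hi⟩ : ∃ i, ∀ᶠ x in 𝓝[≠] x₀, φ x i ≠ 0 := by
    by_contra! hne
    refine hφ0 ?_
    have : ∀ i, ∀ᶠ x in 𝓝[≠] x₀, φ x i = 0 := fun i =>
      (h1 i).eventually_eq_zero_or_eventually_ne_zero.resolve_right (hne i)
    filter_upwards [eventually_all.2 this] with x hx
    exact funext hx
  have hprop : ∀ᶠ x in 𝓝[≠] x₀, ψ x = (ψ x i / φ x i) • φ x := by
    filter_upwards [hw, hi] with x hx hxi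
    rw [wronskian] at hx
    ext j
    rw [Pi.smul_apply, smul_eq_mul, div_mul_eq_mul_div, eq_div_iff hxi]
    fin_cases i <;> fin_cases j <;> simp only [Fin.zero_eta, Fin.mk_one]
    · linear_combination hx
    · linear_combination -hx
  obtain ⟨c, hc⟩ := exists_eventually_eq_const_of_deriv_eq_zero ((h2 i).fun_div (h1 i)) (by
    filter_upwards [hφ.eventually_deriv_apply, hψ.eventually_deriv_apply, hi, hprop]
      with x h1 h2 hxi hx
    refine ((h2 i).div (h1 i) hxi).congr_deriv ?_
    rw [div_eq_zero_iff]
    left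
    have : (A x *ᵥ ψ x) i = ψ x i / φ x i * (A x *ᵥ φ x) i := by
      conv_lhs => rw [hx, Matrix.mulVec_smul]
      rfl
    rw [this]
    field_simp
    ring)
  refine ⟨c, ?_⟩
  filter_upwards [hprop, hc] with x hx hxc
  rw [← hxc]
  exact hx

/-- If a traceless system has two independent germs of meromorphic solutions at `x₀`, then they
are a fundamental system on a disc, and every germ of a solution at a point of the disc
continues to the disc. -/
theorem HasTwoGermSolutions.exists_ball (hA : ∀ x, A x 0 0 + A x 1 1 = 0)
    (h : HasTwoGermSolutions A x₀) :
    ∃ r > 0, ∀ y ∈ Metric.ball x₀ r, ∀ χ, IsGermSolution A y χ →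
      ∃ η, (∀ z ∈ Metric.ball x₀ r, IsGermSolution A z η) ∧ η =ᶠ[𝓝[≠] y] χ := by
  obtain ⟨ψ, hψ, hind⟩ := h
  obtain ⟨w, hw⟩ := exists_eventually_wronskian_eq hA (hψ 0) (hψ 1)
  have hw0 : w ≠ 0 := by
    rintro rfl
    obtain ⟨c, hc⟩ := exists_eventually_eq_smul_of_wronskian_eq_zero (hψ 0) (hψ 1) (fun h0 => by
      have := congrFun (hind ![1, 0] (by simpa using h0)) 0
      simp at this) hw
    have := congrFun (hind ![-c, 1] (by
      filter_upwards [hc] with x hx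
      simp [hx])) 1
    simp at this
  have hnear : ∀ᶠ x in 𝓝 x₀, (∀ k, IsGermSolution A x (ψ k)) ∧
      ∀ᶠ z in 𝓝[≠] x, wronskian (ψ 0) (ψ 1) z = w := by
    have hne : ∀ᶠ x in 𝓝[≠] x₀, (∀ k, IsGermSolution A x (ψ k)) ∧
        ∀ᶠ z in 𝓝[≠] x, wronskian (ψ 0) (ψ 1) z = w := by
      filter_upwards [eventually_nhdsNE_eventually_nhds_iff.2 hw,
        eventually_all.2 fun k => eventually_nhdsNE_eventually_nhds_iff.2 (hψ k).equation,
        eventually_all.2 fun k => (hψ k).meromorphicAt.eventually_analyticAt] with x h1 h2 h3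
      exact ⟨fun k => ⟨(h3 k).meromorphicAt, (h2 k).filter_mono nhdsWithin_le_nhds⟩,
        h1.filter_mono nhdsWithin_le_nhds⟩
    filter_upwards [eventually_nhdsWithin_iff.1 hne] with x hx
    rcases eq_or_ne x x₀ with rfl | hx0
    · exact ⟨hψ, hw⟩
    · exact hx hx0
  obtain ⟨r, hr, hball⟩ := Metric.eventually_nhds_iff_ball.1 hnear
  refine ⟨r, hr, fun y hy χ hχ => ?_⟩
  obtain ⟨hψy, hwy⟩ := hball y hy
  obtain ⟨a, ha⟩ := exists_eventually_wronskian_eq hA hχ (hψy 1)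
  obtain ⟨b, hb⟩ := exists_eventually_wronskian_eq hA (hψy 0) hχ
  refine ⟨fun x => ∑ k, (![a / w, b / w] : Fin 2 → ℂ) k • ψ k x,
    fun z hz => IsGermSolution.sum_smul (hball z hz).1 _, ?_⟩
  -- Cramer's rule
  filter_upwards [hwy, ha, hb] with x h1 h2 h3
  rw [wronskian] at h1 h2 h3
  ext i
  simp only [Fin.sum_univ_two, Matrix.cons_val_zero, Matrix.cons_val_one, Pi.add_apply,
    Pi.smul_apply, smul_eq_mul]
  rw [div_mul_eq_mul_div, div_mul_eq_mul_div, ← add_div, div_eq_iff hw0, ← h1, ← h2, ← h3]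
  fin_cases i <;> simp only [Fin.zero_eta, Fin.mk_one] <;> ring

end Wronskian

/-! ### Global and local fundamental systems -/

theorem eventually_codiscrete_iff {s : ℂ → Prop} :
    (∀ᶠ x in codiscrete ℂ, s x) ↔ ∀ x, ∀ᶠ y in 𝓝[≠] x, s y := by
  rw [Filter.Eventually, mem_codiscrete]
  refine forall_congr' fun x => ?_
  rw [disjoint_principal_right, compl_compl]
  rfl

/-- A meromorphic fundamental system exists if and only if it exists near each point. -/
theorem hasMeromorphicFundamentalSystem_iff {p q : ℂ → ℂ} {E : ℂ} :
    HasMeromorphicFundamentalSystem p q E ↔ ∀ x, HasTwoGermSolutions (coeffMatrix p q E) x := by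
  constructor
  · rintro ⟨ψ, hψ, hind⟩ x
    refine ⟨ψ, fun k => ⟨(hψ k).meromorphic x, ?_⟩, fun c hc => hind c ?_⟩
    · filter_upwards [eventually_codiscrete_iff.1 (hψ k).equation x] with y hy
      exact (J_mulVec_add_eq_iff E y _ _).1 hy
    · rw [eventually_codiscrete_iff]
      intro y
      exact eventuallyEq_of_isPreconnected (U := Set.univ) (g := fun _ => 0)
        (fun z _ => MeromorphicAt.fun_sum fun k _ => ((hψ k).meromorphic z).fun_const_smul (c k))
        (fun z _ => MeromorphicAt.const 0 z) isPreconnected_univ (Set.mem_univ x)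
        (Set.mem_univ y) hc
  · intro h
    obtain ⟨ψ, hψ, hind⟩ := h 0
    have hA : ∀ x, coeffMatrix p q E x 0 0 + coeffMatrix p q E x 1 1 = 0 := fun x => by
      simp [coeffMatrix]
    choose η hη hηψ using fun k => exists_continuation
      (P := fun f x => IsGermSolution (coeffMatrix p q E) x f) (fun f x hf => hf.meromorphicAt)
      (fun f g x hf hfg => hf.congr EventuallyEq.rfl hfg) (fun x => (h x).exists_ball hA) (hψ k)
    refine ⟨η, fun k => ⟨fun x => (hη k x).meromorphicAt, ?_⟩, fun c hc => hind c ?_⟩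
    · rw [eventually_codiscrete_iff]
      intro x
      filter_upwards [(hη k x).equation] with y hy
      exact (J_mulVec_add_eq_iff E y _ _).2 hy
    · filter_upwards [eventually_codiscrete_iff.1 hc 0, eventually_all.2 hηψ] with x h1 h2
      rw [← h1]
      simp only [h2]

end AKNS

theorem theoremt05051 (p q : ℂ → ℂ) (hp : Meromorphic p) (hq : Meromorphic q) :
    ∃ N : ℕ, ∀ S : Finset ℂ, N ≤ S.card →
      (∀ E ∈ S, AKNS.HasMeromorphicFundamentalSystem p q E) →
        ∀ E : ℂ, AKNS.HasMeromorphicFundamentalSystem p q E := by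
  by_cases hall : ∀ E : ℂ, AKNS.HasMeromorphicFundamentalSystem p q E
  · exact ⟨0, fun _ _ _ => hall⟩
  push Not at hall
  obtain ⟨E₀, hE₀⟩ := hall
  rw [AKNS.hasMeromorphicFundamentalSystem_iff] at hE₀
  push Not at hE₀
  obtain ⟨x₀, hx₀⟩ := hE₀
  -- an obstruction at the single point `x₀` bounds the number of good `E`
  have hfin := (AKNS.finite_setOf_hasTwoGermSolutions_coeffMatrix_or_forall (hp x₀)
    (hq x₀)).resolve_right fun h => hx₀ (h E₀)
  refine ⟨hfin.toFinset.card + 1, fun S hS hgood => ?_⟩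
  have hsub : S ⊆ hfin.toFinset := fun E hE => by
    rw [Set.Finite.mem_toFinset]
    exact AKNS.hasMeromorphicFundamentalSystem_iff.1 (hgood E hE) x₀
  have := Finset.card_le_card hsub
  lia
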